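/- Let $G$ be a locally profinite group (a locally compact, totally disconnected Hausdorff topological group) and let $k$ be a field. **Definitions.** A $k$-linear representation $M$ of $G$ is *smooth* if the stabilizer of every vector is open; $G\text{-smooth}_k$ is the full subcategory of smooth representations in the category of all $k$-linear representations of $G$. For a locally profinite space $X$ and a $k$-vector space $V$, let $V[[X]]$ be the space of finitely additive $V$-valued measures $\mu$ on the open-closed subsets of $X$ that are compactly supported (there is a compact $K\subset X$ with $\mu(U)=0$ for all open-closed $U$ disjoint from $K$). A *$G$-contramodule* over $k$ is a $k$-vector space $P$ with a $k$-linear map $\pi\colon P[[G]]\to P$ such that $\pi$ sends the point measure at $1\in G$ with value $x$ to $x$, and the two maps $P[[G\times G]]\rightrightarrows P[[G]]$, namely the pushforward along the multiplication $G\times G\to G$ and the composition of $P[[G\times G]]\to P[[G]][[G]]$, $\mu\mapsto(B\mapsto(A\mapsto\mu(A\times B)))$, with the map $P[[G]][[G]]\to P[[G]]$ induced by $\pi$, have equal compositions with $\pi$. Morphisms are the linear maps compatible with $\pi$; the category is denoted by $G\text{-contra}_k$. The same definitions apply to any compact open subgroup $H\subset G$ (then $H\text{-smooth}_k=H\text{-discr}_k$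 is the category of discrete $H$-modules), and there are forgetful functors $G\text{-smooth}_k\to H\text{-discr}_k$ and $G\text{-contra}_k\to H\text{-contra}_k$ (in the latter, measures on $H$ are extended by zero to $G$). For a smooth $G$-module $N$ and a vector space $V$, the space $\operatorname{Hom}_k(N,V)$ is a $G$-contramodule with $\pi(\mu)(x)=\int_G\mu_g(gx)$. For a smooth $G$-module $N$ and a $G$-contramodule $P$, the contratensor product $N\odot_{k,G}P$ is the cokernel of the difference of the two maps $N\otimes_kP[[G]]\rightrightarrows N\otimes_kP$, $x\otimes\mu\mapsto x\otimes\pi(\mu)$ and $x\otimes\mu\mapsto\int_G gx\otimes d\mu_g$. Let $S=k(G)$ be the space of compactly supported locally constant functions $G\to k$, with the two commuting smooth $G$-actions by left translations $f\mapsto f(g^{-1}\,\cdot\,)$ and right translations $f\mapsto f(\,\cdot\,g)$. The functor $\Phi_G\colon G\text{-contra}_k\to G\text{-smooth}_k$ is $P\mapsto S\odot_{k,G}P$, formed using the right translations and with $G$ acting through the left translations; the functor $\Psi_G\colon G\text{-smooth}_k\to G\text{-contra}_k$ is $M\mapsto\operatorname{Hom}_{k[G]}(S,M)$, formed using the left translations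 and with the contraaction coming from the right translations. A smooth $G$-module is *semiprojective* if it is a direct summand of $S\otimes_kV$ for some $k$-vector space $V$; a $G$-contramodule is *semiinjective* if it is a direct summand of $\operatorname{Hom}_k(S,V)$ for some $k$-vector space $V$. A smooth $G$-module (respectively, a $G$-contramodule) is *weakly compactly injective* (respectively, *weakly compactly projective*) if, for some compact open subgroup $H\subset G$, it is injective in $H\text{-discr}_k$ (respectively, projective in $H\text{-contra}_k$). **Proposition.** (a) There are enough injective objects in $G\text{-smooth}_k$. For every compact open subgroup $H\subset G$, the forgetful functor $G\text{-smooth}_k\to H\text{-discr}_k$ preserves injectives, so injectives in $G\text{-smooth}_k$ are weakly compactly injective. The functors $\Psi_G$ and $\Phi_G$ restrict to mutually inverse equivalences between the full subcategory of injective objects in $G\text{-smooth}_k$ and the full subcategory of semiinjective objects in $G\text{-contra}_k$. (b) There are enough projective objects in $G\text{-contra}_k$. For every compact open subgroup $H\subset G$, the forgetful functor $G\text{-contra}_k\to H\text{-contra}_k$ preserves projectives, so projectives in $G\text{-contra}_k$ are weakly compactly projective. The functors $\Phi_G$ and $\Psi_G$ restrict to mutually inverse equivalences between the full subcategory of projective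 objects in $G\text{-contra}_k$ and the full subcategory of semiprojective objects in $G\text{-smooth}_k$. -/

import Mathlib

open CategoryTheory TopologicalSpace
open scoped TensorProduct

universe u

namespace LocProf

noncomputable section

/-! ### Compactly supported finitely additive measures on open-closed sets -/

section Measures

variable (k : Type*) [Field k]
variable {X Y Z : Type*} [TopologicalSpace X] [TopologicalSpace Y] [TopologicalSpace Z]
variable {V W : Type*} [AddCommGroup V] [Module k V] [AddCommGroup W] [Module k W]

/-- `Meas k X V` is the space `V[[X]]` of compactly supported finitely additive `V`-valued measures
defined on all the open-closed subsets of `X`. -/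
def Meas (X : Type*) [TopologicalSpace X] (V : Type*) [AddCommGroup V] [Module k V] :
    Submodule k (Clopens X → V) where
  carrier := {μ | (∀ A B : Clopens X, Disjoint (A : Set X) B → μ (A ⊔ B) = μ A + μ B) ∧
    ∃ K : Set X, IsCompact K ∧ ∀ A : Clopens X, Disjoint (A : Set X) K → μ A = 0}
  zero_mem' := ⟨fun _ _ _ => by simp, ∅, isCompact_empty, fun _ _ => rfl⟩
  add_mem' := by
    rintro μ ν ⟨h1, K, hK, h2⟩ ⟨h3, L, hL, h4⟩
    refine ⟨fun A B h => ?_, K ∪ L, hK.union hL, fun A h => ?_⟩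
    · simp only [Pi.add_apply, h1 A B h, h3 A B h]; abel
    · rw [Set.disjoint_union_right] at h
      simp [h2 A h.1, h4 A h.2]
  smul_mem' := by
    rintro c μ ⟨h1, K, hK, h2⟩
    refine ⟨fun A B h => ?_, K, hK, fun A h => ?_⟩
    · simp [h1 A B h]
    · simp [h2 A h]

variable {k}

theorem Meas.add_of_disjoint (μ : Meas k X V) (A B : Clopens X) (h : Disjoint (A : Set X) B) :
    μ.1 (A ⊔ B) = μ.1 A + μ.1 B := μ.2.1 A B h

theorem Meas.empty (μ : Meas k X V) (A : Clopens X) (h : (A : Set X) = ∅) : μ.1 A = 0 := by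
  obtain ⟨K, -, hK⟩ := μ.2.2
  exact hK A (by simp [h])

/-- Preimage of an open-closed set under a continuous map. -/
def preim (f : C(X, Y)) (A : Clopens Y) : Clopens X := ⟨f ⁻¹' A, A.isClopen.preimage f.continuous⟩

/-- Pushforward of measures along a continuous map. -/
def Meas.push (f : C(X, Y)) : Meas k X V →ₗ[k] Meas k Y V where
  toFun μ := ⟨fun A => μ.1 (preim f A), by
    obtain ⟨K, hK, h⟩ := μ.2.2
    refine ⟨fun A B hAB => ?_, f '' K, hK.image f.continuous, fun A hA => h _ ?_⟩
    · exact Meas.add_of_disjoint μ (preim f A) (preim f B) (hAB.preimage f)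
    · rw [Set.disjoint_left] at hA ⊢
      exact fun x hx hxK => hA hx ⟨x, hxK, rfl⟩⟩
  map_add' _ _ := rfl
  map_smul' _ _ := rfl

/-- The map `V[[X]] → W[[X]]` induced by a linear map `V → W`. -/
def Meas.map (φ : V →ₗ[k] W) : Meas k X V →ₗ[k] Meas k X W where
  toFun μ := ⟨fun A => φ (μ.1 A), by
    obtain ⟨K, hK, h⟩ := μ.2.2
    exact ⟨fun A B hAB => by simp only [Meas.add_of_disjoint μ _ _ hAB, map_add], K, hK,
      fun A hA => by simp only [h A hA, map_zero]⟩⟩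
  map_add' _ _ := by ext; simp
  map_smul' _ _ := by ext; simp

open Classical in
/-- The point measure at `x`. -/
def Meas.dirac (x : X) : V →ₗ[k] Meas k X V where
  toFun v := ⟨fun A => if x ∈ A then v else 0, by
    refine ⟨fun A B hAB => ?_, {x}, isCompact_singleton, fun A hA => ?_⟩
    · have h : ¬ (x ∈ A ∧ x ∈ B) := fun h => Set.disjoint_left.1 hAB h.1 h.2
      have h' : x ∈ A ⊔ B ↔ x ∈ A ∨ x ∈ B := Iff.rfl
      by_cases hA : x ∈ A <;> by_cases hB : x ∈ B <;> simp_all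
    · exact if_neg (by simpa using hA)⟩
  map_add' _ _ := by ext A; by_cases h : x ∈ A <;> simp [h]
  map_smul' _ _ := by ext A; by_cases h : x ∈ A <;> simp [h]

/-- The product of two open-closed sets. -/
def prodC (A : Clopens X) (B : Clopens Y) : Clopens (X × Y) :=
  ⟨(A : Set X) ×ˢ (B : Set Y), A.isClopen.prod B.isClopen⟩

/-- The natural map `V[[X × Y]] → V[[X]][[Y]]`, sending `μ` to `B ↦ (A ↦ μ (A × B))`. -/
def Meas.curry : Meas k (X × Y) V →ₗ[k] Meas k Y (Meas k X V) where
  toFun μ := ⟨fun B => ⟨fun A => μ.1 (prodC A B), by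
      obtain ⟨K, hK, h⟩ := μ.2.2
      refine ⟨fun A A' hA => ?_, Prod.fst '' K, hK.image continuous_fst, fun A hA => h _ ?_⟩
      · rw [← Meas.add_of_disjoint μ (prodC A B) (prodC A' B) (Set.disjoint_left.2 fun p hp hp' =>
          Set.disjoint_left.1 hA hp.1 hp'.1)]
        exact congrArg μ.1 (Clopens.ext Set.union_prod)
      · exact Set.disjoint_left.2 fun p hp hpK => Set.disjoint_left.1 hA hp.1 ⟨p, hpK, rfl⟩⟩, by
    obtain ⟨K, hK, h⟩ := μ.2.2
    refine ⟨fun B B' hB => ?_, Prod.snd '' K, hK.image continuous_snd, fun B hB => ?_⟩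
    · ext A
      change μ.1 _ = μ.1 _ + μ.1 _
      rw [← Meas.add_of_disjoint μ (prodC A B) (prodC A B') (Set.disjoint_left.2 fun p hp hp' =>
          Set.disjoint_left.1 hB hp.2 hp'.2)]
      exact congrArg μ.1 (Clopens.ext Set.prod_union)
    · ext A
      exact h _ (Set.disjoint_left.2 fun p hp hpK => Set.disjoint_left.1 hB hp.2 ⟨p, hpK, rfl⟩)⟩
  map_add' _ _ := rfl
  map_smul' _ _ := rfl

/-! ### Integration of locally constant functions -/

variable {A A' : Type*}

/-- The fibre of a locally constant function, as an open-closed set. -/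
def fib (f : X → A) (hf : IsLocallyConstant f) (a : A) : Clopens X :=
  ⟨f ⁻¹' {a}, hf.isClosed_fiber a, hf.isOpen_fiber a⟩

theorem mem_fib (f : X → A) (hf : IsLocallyConstant f) (a : A) (x : X) :
    x ∈ (fib f hf a : Set X) ↔ f x = a := Iff.rfl

theorem image_finite (f : X → A) (hf : IsLocallyConstant f) (K : Set X) (hK : IsCompact K) :
    (f '' K).Finite := by
  let _ : TopologicalSpace A := ⊥
  have : DiscreteTopology A := ⟨rfl⟩
  exact (hK.image hf.continuous).finite_of_discrete

theorem Meas.sum_fib [DecidableEq A] (μ : Meas k X V) (f : X → A) (hf : IsLocallyConstant f)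
    (T : Finset A) (U : Clopens X)
    (hU : ∀ B : Clopens X, (∀ x ∈ B, x ∈ U ∧ f x ∉ T) → μ.1 B = 0) :
    μ.1 U = ∑ a ∈ T, μ.1 (U ⊓ fib f hf a) := by
  induction T using Finset.induction_on generalizing U with
  | empty => simpa using hU U (fun x hx => ⟨hx, by simp⟩)
  | insert a T ha ih =>
    rw [Finset.sum_insert ha]
    have h1 : μ.1 U = μ.1 (U ⊓ fib f hf a) + μ.1 (U \ fib f hf a) := by
      rw [← Meas.add_of_disjoint μ]
      · refine congrArg μ.1 (Clopens.ext ?_)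
        ext x
        simp
      · exact Set.disjoint_left.2 fun x hx hx' => hx'.2 hx.2
    rw [h1, ih (U \ fib f hf a)]
    · congr 1
      refine Finset.sum_congr rfl fun b hb => congrArg μ.1 (Clopens.ext ?_)
      ext x
      refine ⟨fun h => ⟨h.1.1, h.2⟩, fun h => ⟨⟨h.1, fun h' => ?_⟩, h.2⟩⟩
      have h2 : f x = b := h.2
      have h3 : f x = a := h'
      exact ha (by rwa [← h3, h2])
    · intro B hB
      refine hU B fun x hx => ⟨(hB x hx).1.1, ?_⟩
      have h3 : f x ≠ a := (hB x hx).1.2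
      simp [h3, (hB x hx).2]

theorem Meas.exists_finset (μ : Meas k X V) (f : X → A) (hf : IsLocallyConstant f) :
    ∃ T : Finset A, ∀ B : Clopens X, (∀ x ∈ B, f x ∉ T) → μ.1 B = 0 := by
  obtain ⟨K, hK, h⟩ := μ.2.2
  refine ⟨(image_finite f hf K hK).toFinset, fun B hB => h B ?_⟩
  refine Set.disjoint_left.2 fun x hx hxK => hB x hx ?_
  simpa using ⟨x, hxK, rfl⟩

theorem Meas.support_finite (μ : Meas k X V) (f : X → A) (hf : IsLocallyConstant f)
    (F : A → V →ₗ[k] W) : (Function.support fun a => F a (μ.1 (fib f hf a))).Finite := by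
  obtain ⟨T, hT⟩ := Meas.exists_finset μ f hf
  refine T.finite_toSet.subset fun a ha => ?_
  by_contra haT
  refine ha ?_
  change F a _ = 0
  rw [hT _ (fun x hx => ?_), map_zero]
  rw [(mem_fib f hf a x).1 hx]
  exact haT

/-- The integral `∫ F (f x) dμ_x` of a locally constant function `f` against a compactly supported
measure `μ`, the values being paired by `F`: the (finite) sum of `F a (μ {x | f x = a})`. -/
def integ (f : X → A) (hf : IsLocallyConstant f) (F : A → V →ₗ[k] W) : Meas k X V →ₗ[k] W where
  toFun μ := ∑ᶠ a, F a (μ.1 (fib f hf a))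
  map_add' μ ν := by
    rw [← finsum_add_distrib (Meas.support_finite μ f hf F) (Meas.support_finite ν f hf F)]
    exact finsum_congr fun a => (F a).map_add _ _
  map_smul' c μ := by
    rw [RingHom.id_apply, smul_finsum' _ (Meas.support_finite μ f hf F)]
    exact finsum_congr fun a => (F a).map_smul _ _

theorem integ_apply (f : X → A) (hf : IsLocallyConstant f) (F : A → V →ₗ[k] W) (μ : Meas k X V) :
    integ f hf F μ = ∑ᶠ a, F a (μ.1 (fib f hf a)) := rfl

/-- Change of variables along a map of values. -/
theorem integ_comp (f : X → A) (hf : IsLocallyConstant f) (φ : A → A')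
    (hf' : IsLocallyConstant (φ ∘ f)) (F : A' → V →ₗ[k] W) (μ : Meas k X V) :
    integ (φ ∘ f) hf' F μ = integ f hf (fun a => F (φ a)) μ := by
  classical
  obtain ⟨T, hT⟩ := Meas.exists_finset μ f hf
  have h1 : ∀ a, a ∉ T → μ.1 (fib f hf a) = 0 := fun a ha =>
    hT _ fun x hx => by rw [(mem_fib f hf a x).1 hx]; exact ha
  have h2 : ∀ a', μ.1 (fib (φ ∘ f) hf' a') =
      ∑ a ∈ T, if φ a = a' then μ.1 (fib f hf a) else 0 := by
    intro a'
    rw [Meas.sum_fib μ f hf T _ fun B hB => hT B fun x hx => (hB x hx).2]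
    refine Finset.sum_congr rfl fun a _ => ?_
    split_ifs with h
    · refine congrArg μ.1 (Clopens.ext ?_)
      ext x
      refine ⟨fun hx => hx.2, fun hx => ⟨?_, hx⟩⟩
      have : f x = a := hx
      change φ (f x) = a'
      rw [this, h]
    · refine Meas.empty μ _ (Set.eq_empty_of_forall_notMem fun x hx => h ?_)
      have e1 : φ (f x) = a' := hx.1
      have e2 : f x = a := hx.2
      rw [← e2, e1]
  rw [integ_apply, integ_apply, finsum_eq_sum_of_support_subset (s := T.image φ),
    finsum_eq_sum_of_support_subset (s := T)]
  · simp only [h2, map_sum]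
    rw [Finset.sum_comm]
    refine Finset.sum_congr rfl fun a ha => ?_
    rw [Finset.sum_eq_single (φ a)]
    · simp
    · intro b _ hb
      rw [if_neg (Ne.symm hb), map_zero]
    · intro h
      exact absurd (Finset.mem_image_of_mem φ ha) h
  · intro a ha
    by_contra h
    exact ha (by simp only [h1 a h, map_zero])
  · intro a' ha'
    by_contra h
    refine ha' ?_
    change F a' _ = 0
    rw [h2, Finset.sum_eq_zero, map_zero]
    intro a ha
    refine if_neg fun h' => h ?_
    rw [← h']
    exact Finset.mem_coe.2 (Finset.mem_image_of_mem φ ha)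

end Measures

/-! ### Contramodules -/

/-- A `G`-contramodule over `k`: a vector space with a linear contraaction map `π : P[[G]] → P`
such that the two maps `P[[G × G]] ⇉ P[[G]]` (pushforward along the multiplication; and
`P[[G × G]] → P[[G]][[G]] → P[[G]]`, the latter map being induced by `π`) have equal compositions
with `π`, and such that `π` sends the point measure at `1` with the value `x` to `x`. -/
structure Contramodule (k G : Type u) [Field k] [Group G] [TopologicalSpace G]
    [IsTopologicalGroup G] where
  carrier : Type u
  [addCommGroup : AddCommGroup carrier]
  [module : Module k carrier]
  π : Meas k G carrier →ₗ[k] carrier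
  assoc : ∀ μ : Meas k (G × G) carrier,
    π (Meas.push ⟨fun p : G × G => p.1 * p.2, continuous_mul⟩ μ) = π (Meas.map π (Meas.curry μ))
  unit : ∀ x, π (Meas.dirac (1 : G) x) = x

section Contra

variable {k G : Type u} [Field k] [Group G] [TopologicalSpace G] [IsTopologicalGroup G]

attribute [instance] Contramodule.addCommGroup Contramodule.module

/-- Morphisms of contramodules: linear maps commuting with the contraactions. -/
@[ext]
structure Contramodule.Hom (P Q : Contramodule k G) where
  lin : P.carrier →ₗ[k] Q.carrier
  comm : ∀ μ, lin (P.π μ) = Q.π (Meas.map lin μ)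

instance : Category (Contramodule k G) where
  Hom := Contramodule.Hom
  id P := ⟨LinearMap.id, fun _ => rfl⟩
  comp f g := ⟨g.lin ∘ₗ f.lin, fun μ => by
    rw [LinearMap.comp_apply, f.comm, g.comm]; rfl⟩

@[simp] theorem Contramodule.comp_lin {P Q R : Contramodule k G} (f : P ⟶ Q) (g : Q ⟶ R) :
    Contramodule.Hom.lin (f ≫ g) = g.lin ∘ₗ f.lin := rfl

@[simp] theorem Contramodule.id_lin (P : Contramodule k G) :
    Contramodule.Hom.lin (𝟙 P) = LinearMap.id := rfl

/-- The inclusion of a subgroup, as a continuous map. -/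
def incl (H : Subgroup G) : C(H, G) := ⟨fun h => (h : G), continuous_subtype_val⟩

/-- The forgetful functor from `G`-contramodules to `H`-contramodules; measures on `H` are extended
by zero to (that is, pushed forward to) `G`. -/
def Contramodule.res (k : Type u) [Field k] (H : Subgroup G) :
    Contramodule k G ⥤ Contramodule k H where
  obj P :=
    { carrier := P.carrier
      π := P.π ∘ₗ Meas.push (incl H)
      assoc := fun μ => by
        have h := P.assoc (Meas.push ⟨fun p : H × H => ((p.1 : G), (p.2 : G)), by fun_prop⟩ μ)
        exact h
      unit := fun x => P.unit x }
  map f := ⟨f.lin, fun μ => f.comm _⟩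

/-- A subspace of a contramodule closed under the contraaction. -/
abbrev Contramodule.sub (P : Contramodule k G) (E : Submodule k P.carrier)
    (hE : ∀ μ : Meas k G E, P.π (Meas.map E.subtype μ) ∈ E) : Contramodule k G where
  carrier := E
  π := (P.π ∘ₗ Meas.map E.subtype).codRestrict E hE
  assoc μ := Subtype.ext (P.assoc (Meas.map E.subtype μ))
  unit x := by
    refine Subtype.ext (Eq.trans (congrArg P.π (Subtype.ext (funext fun A => ?_))) (P.unit x.1))
    by_cases h : (1 : G) ∈ A <;> simp [Meas.map, Meas.dirac, h]

end Contra

/-! ### Smooth modules -/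

section Smooth

variable {k G : Type u} [Field k] [Group G] [TopologicalSpace G] [IsTopologicalGroup G]
variable {N M V W P : Type*} [AddCommGroup N] [Module k N] [AddCommGroup M] [Module k M]
  [AddCommGroup V] [Module k V] [AddCommGroup W] [Module k W] [AddCommGroup P] [Module k P]

/-- A representation is smooth if the stabilizer of every vector is open. -/
def IsSmooth (ρ : Representation k G N) : Prop := ∀ x, IsOpen {g : G | ρ g x = x}

variable (k G) in
/-- The category of smooth `G`-modules over `k`, a full subcategory of all `G`-modules. When `G` is
profinite this is the category of discrete `G`-modules. -/
abbrev SmoothMod : Type (u + 1) :=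
  ObjectProperty.FullSubcategory (fun M : Rep.{u} k G => IsSmooth M.ρ)

/-- The forgetful functor from smooth `G`-modules to smooth `H`-modules. -/
def SmoothMod.res (k : Type u) [Field k] (H : Subgroup G) : SmoothMod k G ⥤ SmoothMod k H :=
  ObjectProperty.lift _ (ObjectProperty.ι _ ⋙ Rep.resFunctor H.subtype)
    fun M x => (M.property x).preimage continuous_subtype_val

theorem IsSmooth.orbit {ρ : Representation k G N} (hρ : IsSmooth ρ) (x : N) :
    IsLocallyConstant fun g => ρ g x := by
  rw [IsLocallyConstant.iff_exists_open]
  intro g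
  refine ⟨(fun h => g⁻¹ * h) ⁻¹' {h : G | ρ h x = x}, (hρ x).preimage (by fun_prop), by simp, ?_⟩
  intro h hh
  have h1 : ρ (g⁻¹ * h) x = x := hh
  have h2 : ρ g (ρ (g⁻¹ * h) x) = ρ h x := by
    rw [← Module.End.mul_apply, ← map_mul, mul_inv_cancel_left]
  rw [← h2, h1]

theorem isSmooth_of_mem_nhds {ρ : Representation k G N}
    (h : ∀ x, {g : G | ρ g x = x} ∈ nhds (1 : G)) : IsSmooth ρ := by
  intro x
  let S : Subgroup G :=
    { carrier := {g : G | ρ g x = x}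
      one_mem' := by simp
      mul_mem' := fun {a b} ha hb => by
        have ha' : ρ a x = x := ha
        have hb' : ρ b x = x := hb
        simp [ha', hb']
      inv_mem' := fun {a} ha => by
        have ha' : ρ a x = x := ha
        change ρ a⁻¹ x = x
        conv_lhs => rw [← ha']
        simp }
  exact S.isOpen_of_mem_nhds (h x)

/-- For a smooth module `N` and a bilinear map `B : N × P → W`, the bilinear map
`(x, μ) ↦ ∫ B (g x) dμ_g` from `N × P[[G]]` to `W`. -/
def actInteg (ρ : Representation k G N) (hρ : IsSmooth ρ) (B : N →ₗ[k] P →ₗ[k] W) :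
    N →ₗ[k] Meas k G P →ₗ[k] W where
  toFun x := integ (fun g => ρ g x) (hρ.orbit x) fun n => B n
  map_add' x y := by
    ext μ
    have hf : IsLocallyConstant fun g => (ρ g x, ρ g y) := (hρ.orbit x).prodMk (hρ.orbit y)
    have h1 := integ_comp _ hf Prod.fst (hρ.orbit x) (fun n => B n) μ
    have h2 := integ_comp _ hf Prod.snd (hρ.orbit y) (fun n => B n) μ
    have h3 := integ_comp _ hf (fun p => p.1 + p.2)
      (by simpa [Function.comp_def] using hρ.orbit (x + y)) (fun n => B n) μ
    have h4 : integ (fun g => ρ g (x + y)) (hρ.orbit (x + y)) (fun n => B n) μ =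
        integ ((fun p : N × N => p.1 + p.2) ∘ fun g => (ρ g x, ρ g y))
          (by simpa [Function.comp_def] using hρ.orbit (x + y)) (fun n => B n) μ := by
      congr! 1
      congr! 1
      ext g
      simp
    rw [LinearMap.add_apply, h4, h3]
    refine Eq.trans ?_ (congrArg₂ (· + ·) h1 h2).symm
    simp only [integ_apply]
    rw [← finsum_add_distrib (Meas.support_finite μ _ hf fun p => B p.1)
      (Meas.support_finite μ _ hf fun p => B p.2)]
    exact finsum_congr fun p => by simp
  map_smul' c x := by
    ext μ
    have h3 := integ_comp _ (hρ.orbit x) (fun n => c • n)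
      (by simpa [Function.comp_def] using hρ.orbit (c • x)) (fun n => B n) μ
    have h4 : integ (fun g => ρ g (c • x)) (hρ.orbit (c • x)) (fun n => B n) μ =
        integ ((fun n : N => c • n) ∘ fun g => ρ g x)
          (by simpa [Function.comp_def] using hρ.orbit (c • x)) (fun n => B n) μ := by
      congr! 1
      congr! 1
      ext g
      simp
    rw [h4, h3, RingHom.id_apply, LinearMap.smul_apply]
    simp only [integ_apply]
    rw [smul_finsum' _ (Meas.support_finite μ _ _ fun n => B n)]
    exact finsum_congr fun p => by simp

theorem actInteg_apply (ρ : Representation k G N) (hρ : IsSmooth ρ) (B : N →ₗ[k] P →ₗ[k] W)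
    (x : N) (μ : Meas k G P) :
    actInteg ρ hρ B x μ = ∑ᶠ n, B n (μ.1 (fib (fun g => ρ g x) (hρ.orbit x) n)) := rfl

theorem actInteg_equivariant (ρ : Representation k G N) (hρ : IsSmooth ρ) (B : N →ₗ[k] P →ₗ[k] W)
    (T : N →ₗ[k] N) (hT : ∀ g x, ρ g (T x) = T (ρ g x)) (x : N) (μ : Meas k G P) :
    actInteg ρ hρ B (T x) μ = actInteg ρ hρ (B ∘ₗ T) x μ := by
  have h3 := integ_comp _ (hρ.orbit x) (fun n => T n)
    (by simpa only [Function.comp_def, hT] using hρ.orbit (T x)) (fun n => B n) μ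
  refine Eq.trans ?_ h3
  change integ _ _ _ _ = _
  congr! 1
  congr! 1
  ext g
  exact hT g x

theorem actInteg_comp (ρ : Representation k G N) (hρ : IsSmooth ρ) (B : N →ₗ[k] P →ₗ[k] W)
    (L : W →ₗ[k] V) (x : N) (μ : Meas k G P) :
    L (actInteg ρ hρ B x μ) = actInteg ρ hρ (B.compr₂ L) x μ := by
  rw [actInteg_apply, actInteg_apply]
  exact L.toAddMonoidHom.map_finsum (Meas.support_finite μ _ (hρ.orbit x) fun n => B n)

theorem actInteg_dirac (ρ : Representation k G N) (hρ : IsSmooth ρ) (B : N →ₗ[k] P →ₗ[k] W)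
    (x : N) (g : G) (p : P) : actInteg ρ hρ B x (Meas.dirac g p) = B (ρ g x) p := by
  rw [actInteg_apply, finsum_eq_single _ (ρ g x)]
  · congr 1
    exact if_pos rfl
  · intro n hn
    have : (Meas.dirac (k := k) g p).1 (fib (fun g => ρ g x) (hρ.orbit x) n) = 0 :=
      if_neg fun h => hn h.symm
    rw [this, map_zero]

end Smooth

section Functors

variable {k G : Type u} [Field k] [Group G] [TopologicalSpace G] [IsTopologicalGroup G]

/-- The contramodule `Hom_k(N, V)` for a smooth module `N` and a vector space `V`, with the
contraaction `π(μ)(x) = ∫ μ_g(g x)`. -/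
abbrev homContra {N : Type u} [AddCommGroup N] [Module k N] (ρ : Representation k G N)
    (hρ : IsSmooth ρ) (V : Type u) [AddCommGroup V] [Module k V] : Contramodule k G where
  carrier := N →ₗ[k] V
  π := (actInteg ρ hρ LinearMap.applyₗ).flip
  assoc μ := by
    ext x
    let f : G × G → N × N := fun p => (ρ p.2 x, ρ (p.1 * p.2) x)
    have h0 : IsLocallyConstant fun p : G × G => ρ (p.1 * p.2) x :=
      (hρ.orbit x).comp_continuous continuous_mul
    have hf : IsLocallyConstant f :=
      ((hρ.orbit x).comp_continuous continuous_snd).prodMk h0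
    have h1 := integ_comp f hf Prod.snd h0 (fun n => (LinearMap.applyₗ n : (N →ₗ[k] V) →ₗ[k] V)) μ
    refine Eq.trans h1 ?_
    rw [integ_apply, finsum_curry _ (Meas.support_finite μ f hf fun a =>
      (LinearMap.applyₗ a.2 : (N →ₗ[k] V) →ₗ[k] V))]
    refine finsum_congr fun m => finsum_congr fun n => ?_
    change (μ.1 _) n = (μ.1 _) n
    refine congrArg (fun U => (μ.1 U) n) (Clopens.ext ?_)
    ext p
    change (ρ p.2 x, ρ (p.1 * p.2) x) = (m, n) ↔ ρ p.1 m = n ∧ ρ p.2 x = m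
    rw [Prod.mk.injEq, map_mul, Module.End.mul_apply]
    constructor
    · rintro ⟨rfl, h⟩
      exact ⟨h, rfl⟩
    · rintro ⟨h, rfl⟩
      exact ⟨rfl, h⟩
  unit φ := by
    ext x
    rw [LinearMap.flip_apply, actInteg_dirac]
    simp

/-! ### The smooth `G × G`-module of compactly supported locally constant functions -/

variable (k G) in
/-- `Fn k G` is the space `k(G)` of compactly supported locally constant functions `G → k`. -/
def Fn : Submodule k (G → k) where
  carrier := {f | IsLocallyConstant f ∧ HasCompactSupport f}
  zero_mem' := ⟨IsLocallyConstant.const 0, HasCompactSupport.zero⟩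
  add_mem' hf hg := ⟨hf.1.add hg.1, hf.2.add hg.2⟩
  smul_mem' c _ hf := ⟨hf.1.comp fun a => c * a, hf.2.comp_left (g := fun a => c * a) (mul_zero c)⟩

variable (k G) in
/-- The action of `G` on `k(G)` by left translations, `(g f)(x) = f(g⁻¹ x)`. -/
def leftReg : Representation k G (Fn k G) where
  toFun g :=
    { toFun := fun f => ⟨fun x => f.1 (g⁻¹ * x), f.2.1.comp_continuous (continuous_const_mul g⁻¹),
        f.2.2.comp_homeomorph (Homeomorph.mulLeft g⁻¹)⟩
      map_add' := fun _ _ => rfl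
      map_smul' := fun _ _ => rfl }
  map_one' := by ext f x; simp
  map_mul' g h := by ext f x; simp [mul_assoc]

variable (k G) in
/-- The action of `G` on `k(G)` by right translations, `(g f)(x) = f(x g)`. -/
def rightReg : Representation k G (Fn k G) where
  toFun g :=
    { toFun := fun f => ⟨fun x => f.1 (x * g), f.2.1.comp_continuous (continuous_mul_const g),
        f.2.2.comp_homeomorph (Homeomorph.mulRight g)⟩
      map_add' := fun _ _ => rfl
      map_smul' := fun _ _ => rfl }
  map_one' := by ext f x; simp
  map_mul' g h := by ext f x; simp [mul_assoc]

theorem rightReg_leftReg (g h : G) (f : Fn k G) :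
    rightReg k G g (leftReg k G h f) = leftReg k G h (rightReg k G g f) := by
  ext x
  simp [leftReg, rightReg, mul_assoc]

/-- A compactly supported locally constant function is invariant under all translations (along a
jointly continuous family `m` of maps with `m 1 = id`) by elements close to `1`. -/
theorem translate_eventually (f : Fn k G) (m : G → G → G)
    (hm : Continuous fun p : G × G => m p.1 p.2) (h1 : ∀ x, m 1 x = x)
    (hinv : ∀ g x, m g⁻¹ (m g x) = x) :
    {g : G | ∀ x, f.1 (m g x) = f.1 x} ∈ nhds (1 : G) := by
  have hfm : IsLocallyConstant fun p : G × G => (f.1 (m p.1 p.2), f.1 p.2) :=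
    (f.2.1.comp_continuous hm).prodMk (f.2.1.comp_continuous continuous_snd)
  have hopen : IsOpen {p : G × G | f.1 (m p.1 p.2) = f.1 p.2} := hfm {q | q.1 = q.2}
  have hK : IsCompact (tsupport f.1) := f.2.2
  obtain ⟨U, W, hU, -, h1U, hKW, hUW⟩ := generalized_tube_lemma (isCompact_singleton (x := (1 : G)))
    hK hopen (by
      rintro ⟨g, x⟩ ⟨hg, -⟩
      rw [Set.mem_singleton_iff] at hg
      subst hg
      simp [h1])
  have hU1 : U ∈ nhds (1 : G) := hU.mem_nhds (h1U rfl)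
  filter_upwards [hU1, inv_mem_nhds_one G hU1] with g hg hg' x
  by_cases hx : x ∈ tsupport f.1
  · exact hUW (Set.mk_mem_prod hg (hKW hx))
  · by_cases hy : m g x ∈ tsupport f.1
    · have h2 : f.1 (m g⁻¹ (m g x)) = f.1 (m g x) := hUW (Set.mk_mem_prod hg' (hKW hy))
      rw [hinv] at h2
      exact h2.symm
    · rw [image_eq_zero_of_notMem_tsupport hx, image_eq_zero_of_notMem_tsupport hy]

variable (k G) in
theorem leftReg_smooth : IsSmooth (leftReg k G) := by
  refine isSmooth_of_mem_nhds fun f => ?_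
  filter_upwards [translate_eventually f (fun g x => g⁻¹ * x) (by fun_prop) (by simp) (by simp)]
    with g hg
  exact Subtype.ext (funext hg)

variable (k G) in
theorem rightReg_smooth : IsSmooth (rightReg k G) := by
  refine isSmooth_of_mem_nhds fun f => ?_
  filter_upwards [translate_eventually f (fun g x => x * g) (by fun_prop) (by simp) (by simp)]
    with g hg
  exact Subtype.ext (funext hg)

theorem actInteg_leftReg {P W : Type*} [AddCommGroup P] [Module k P] [AddCommGroup W] [Module k W]
    (B : Fn k G →ₗ[k] P →ₗ[k] W) (g : G) (f : Fn k G) (μ : Meas k G P) :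
    actInteg (rightReg k G) (rightReg_smooth k G) B (leftReg k G g f) μ =
      actInteg (rightReg k G) (rightReg_smooth k G) (B ∘ₗ leftReg k G g) f μ :=
  actInteg_equivariant (rightReg k G) (rightReg_smooth k G) B (leftReg k G g) (fun h f => rightReg_leftReg h g f) f μ

/-! ### Contratensor product and the functors `Φ` and `Ψ` -/

/-- The difference of the two natural maps `N ⊗ P[[G]] ⇉ N ⊗ P`, one of them induced by the
contraaction, the other one sending `x ⊗ μ` to `∫ g x ⊗ dμ_g`. -/
def contraDiff {N : Type u} [AddCommGroup N] [Module k N] (ρ : Representation k G N)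
    (hρ : IsSmooth ρ) (P : Contramodule k G) :
    N ⊗[k] Meas k G P.carrier →ₗ[k] N ⊗[k] P.carrier :=
  P.π.lTensor N - TensorProduct.lift (actInteg ρ hρ (TensorProduct.mk k N P.carrier))

/-- The contratensor product of a smooth module `N` and a contramodule `P`. -/
abbrev Contratensor {N : Type u} [AddCommGroup N] [Module k N] (ρ : Representation k G N)
    (hρ : IsSmooth ρ) (P : Contramodule k G) : Type u :=
  (N ⊗[k] P.carrier) ⧸ LinearMap.range (contraDiff ρ hρ P)

/-- `S ⊗ V` for a vector space `V`, where `S = k(G)` with the left translation action. -/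
def tensorRep (V : Type u) [AddCommGroup V] [Module k V] :
    Representation k G (Fn k G ⊗[k] V) where
  toFun g := (leftReg k G g).rTensor V
  map_one' := by rw [map_one]; exact LinearMap.rTensor_id _ _
  map_mul' g h := by rw [map_mul]; exact LinearMap.rTensor_mul _ _ _

theorem tensorRep_smooth (V : Type u) [AddCommGroup V] [Module k V] :
    IsSmooth (N := Fn k G ⊗[k] V) (tensorRep (k := k) (G := G) V) := by
  refine isSmooth_of_mem_nhds fun t => ?_
  induction t with
  | zero => simp
  | tmul f v =>
    filter_upwards [(leftReg_smooth k G f).mem_nhds (by simp)] with g hg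
    have h : leftReg k G g f = f := hg
    simp [tensorRep, h]
  | add s t hs ht =>
    filter_upwards [hs, ht] with g hg hg'
    have h : tensorRep V g s = s := hg
    have h' : tensorRep V g t = t := hg'
    simp [h, h']

/-- The smooth module `S ⊗ V`, with `S = k(G)` acted upon by left translations. -/
def tensorSmooth (k G : Type u) [Field k] [Group G] [TopologicalSpace G] [IsTopologicalGroup G]
    (V : Type u) [AddCommGroup V] [Module k V] : SmoothMod k G :=
  ⟨Rep.of (X := Fn k G ⊗[k] V) (tensorRep V), tensorRep_smooth V⟩

theorem range_le_comap (P : Contramodule k G) (g : G) :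
    LinearMap.range (contraDiff (rightReg k G) (rightReg_smooth k G) P) ≤
      (LinearMap.range (contraDiff (rightReg k G) (rightReg_smooth k G) P)).comap
        (tensorRep P.carrier g) := by
  rintro _ ⟨t, rfl⟩
  refine ⟨(leftReg k G g).rTensor _ t, ?_⟩
  induction t with
  | zero => simp
  | add s t hs ht => simp only [map_add, hs, ht]
  | tmul f μ =>
    change leftReg k G g f ⊗ₜ[k] P.π μ -
        actInteg (rightReg k G) (rightReg_smooth k G) _ (leftReg k G g f) μ =
      tensorRep P.carrier g
      (f ⊗ₜ[k] P.π μ - actInteg (rightReg k G) (rightReg_smooth k G) _ f μ)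
    rw [map_sub]
    refine congrArg₂ (· - ·) rfl ?_
    rw [actInteg_leftReg]
    exact (actInteg_comp (W := Fn k G ⊗[k] P.carrier) (V := Fn k G ⊗[k] P.carrier) (rightReg k G)
      (rightReg_smooth k G) (TensorProduct.mk k (Fn k G) P.carrier) (tensorRep P.carrier g) f μ).symm

/-- The action of `G` on the contratensor product of `S` and `P`, induced by left translations
on `S`; the contratensor product is formed with respect to right translations on `S`. -/
def phiRep (P : Contramodule k G) :
    Representation k G (Contratensor (rightReg k G) (rightReg_smooth k G) P) where
  toFun g := Submodule.mapQ _ _ (tensorRep P.carrier g) (range_le_comap P g)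
  map_one' := by
    refine Submodule.linearMap_qext _ (LinearMap.ext fun t => ?_)
    simp
  map_mul' g h := by
    refine Submodule.linearMap_qext _ (LinearMap.ext fun t => ?_)
    simp

theorem phiRep_smooth (P : Contramodule k G) : IsSmooth (phiRep P) := by
  refine isSmooth_of_mem_nhds fun t => ?_
  obtain ⟨t, rfl⟩ := Submodule.mkQ_surjective _ t
  filter_upwards [(tensorRep_smooth P.carrier t).mem_nhds (by simp)] with g hg
  exact congrArg (Submodule.mkQ _) hg

/-- The linear map of contratensor products induced by a morphism of contramodules. -/
def contratensorMap {N : Type u} [AddCommGroup N] [Module k N] (ρ : Representation k G N)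
    (hρ : IsSmooth ρ) {P Q : Contramodule k G} (f : P ⟶ Q) :
    Contratensor ρ hρ P →ₗ[k] Contratensor ρ hρ Q :=
  Submodule.mapQ _ _ (LinearMap.lTensor N f.lin) (by
    rintro _ ⟨t, rfl⟩
    refine ⟨(Meas.map f.lin).lTensor _ t, ?_⟩
    induction t with
    | zero => simp
    | add s t hs ht => simp only [map_add, hs, ht]
    | tmul n μ =>
      simp only [contraDiff, LinearMap.sub_apply, LinearMap.lTensor_tmul,
        TensorProduct.lift.tmul, map_sub, ← f.comm]
      congr 1
      rw [actInteg_comp]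
      rfl)

theorem contratensorMap_id {N : Type u} [AddCommGroup N] [Module k N] (ρ : Representation k G N)
    (hρ : IsSmooth ρ) (P : Contramodule k G) :
    contratensorMap ρ hρ (𝟙 P) = LinearMap.id := by
  refine Submodule.linearMap_qext _ (TensorProduct.ext' fun s p => ?_)
  rfl

theorem contratensorMap_comp {N : Type u} [AddCommGroup N] [Module k N] (ρ : Representation k G N)
    (hρ : IsSmooth ρ) {P Q R : Contramodule k G} (f : P ⟶ Q) (g : Q ⟶ R) :
    contratensorMap ρ hρ (f ≫ g) = contratensorMap ρ hρ g ∘ₗ contratensorMap ρ hρ f := by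
  refine Submodule.linearMap_qext _ (TensorProduct.ext' fun s p => ?_)
  rfl

theorem contratensorMap_phiRep {P Q : Contramodule k G} (f : P ⟶ Q) (g : G) :
    contratensorMap (rightReg k G) (rightReg_smooth k G) f ∘ₗ phiRep P g =
      phiRep Q g ∘ₗ contratensorMap (rightReg k G) (rightReg_smooth k G) f := by
  refine Submodule.linearMap_qext _ (TensorProduct.ext' fun s p => ?_)
  rfl

/-- The functor `Φ_G`, taking a contramodule `P` to the contratensor product of `S` and `P`. -/
def Phi (k G : Type u) [Field k] [Group G] [TopologicalSpace G] [IsTopologicalGroup G] :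
    Contramodule k G ⥤ SmoothMod k G where
  obj P := ⟨Rep.of (phiRep P), phiRep_smooth P⟩
  map {P Q} f := ObjectProperty.homMk (Rep.ofHom
    ⟨contratensorMap (rightReg k G) (rightReg_smooth k G) f, contratensorMap_phiRep f⟩)
  map_id P := by
    refine ObjectProperty.hom_ext _ (Rep.hom_ext (Representation.IntertwiningMap.ext ?_))
    exact contratensorMap_id (rightReg k G) (rightReg_smooth k G) P
  map_comp f g := by
    refine ObjectProperty.hom_ext _ (Rep.hom_ext (Representation.IntertwiningMap.ext ?_))
    exact contratensorMap_comp (rightReg k G) (rightReg_smooth k G) f g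

/-- The space `Hom_{k[G]}(S, M)` of `G`-equivariant linear maps, where `G` acts on `S = k(G)` by
left translations. -/
def equivHom {M : Type u} [AddCommGroup M] [Module k M] (ρ : Representation k G M) :
    Submodule k (Fn k G →ₗ[k] M) where
  carrier := {φ | ∀ g f, φ (leftReg k G g f) = ρ g (φ f)}
  zero_mem' := fun g f => by simp
  add_mem' := fun h h' g f => by simp [h g f, h' g f]
  smul_mem' := fun c φ h g f => by simp [h g f]

theorem equivHom_closed {M : Type u} [AddCommGroup M] [Module k M] (ρ : Representation k G M)
    (μ : Meas k G (equivHom ρ)) :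
    (homContra (rightReg k G) (rightReg_smooth k G) M).π (Meas.map (equivHom ρ).subtype μ) ∈
      equivHom ρ := by
  intro g f
  change actInteg (rightReg k G) (rightReg_smooth k G) LinearMap.applyₗ (leftReg k G g f) _ =
    ρ g (actInteg (rightReg k G) (rightReg_smooth k G) LinearMap.applyₗ f _)
  rw [actInteg_leftReg, actInteg_comp, actInteg_apply, actInteg_apply]
  exact finsum_congr fun n => (μ.1 _).2 g n

/-- The contramodule `Hom_{k[G]}(S, M)`; its contraaction comes from the right translations
on `S`. -/
abbrev psiObj {M : Type u} [AddCommGroup M] [Module k M] (ρ : Representation k G M) :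
    Contramodule k G :=
  (homContra (rightReg k G) (rightReg_smooth k G) M).sub (equivHom ρ) (equivHom_closed ρ)

/-- The functor `Ψ_G`, taking a smooth module `M` to the contramodule `Hom_{k[G]}(S, M)`. -/
def Psi (k G : Type u) [Field k] [Group G] [TopologicalSpace G] [IsTopologicalGroup G] :
    SmoothMod k G ⥤ Contramodule k G where
  obj M := psiObj M.obj.ρ
  map {M N} f :=
    { lin := LinearMap.restrict (LinearMap.compRight k f.hom.hom.toLinearMap) (fun φ hφ g s => by
        have h1 : φ (leftReg k G g s) = M.obj.ρ g (φ s) := hφ g s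
        change f.hom.hom (φ (leftReg k G g s)) = N.obj.ρ g (f.hom.hom (φ s))
        rw [h1, Rep.hom_comm_apply])
      comm := fun μ => by
        refine Subtype.ext (LinearMap.ext fun s => ?_)
        change f.hom.hom.toLinearMap (actInteg (rightReg k G) (rightReg_smooth k G) _ _ _) =
          actInteg (rightReg k G) (rightReg_smooth k G) _ _ _
        exact actInteg_comp (rightReg k G) (rightReg_smooth k G) _ f.hom.hom.toLinearMap s _ }
  map_id M := rfl
  map_comp f g := rfl

/-! ### Special classes of objects -/

/-- A smooth module is semiprojective if it is a direct summand of `S ⊗ V` for some `V`. -/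
def IsSemiprojective (M : SmoothMod k G) : Prop :=
  ∃ V : ModuleCat.{u} k, Nonempty (Retract M (tensorSmooth k G V))

/-- A contramodule is semiinjective if it is a direct summand of `Hom_k(S, V)` for some `V`. -/
def IsSemiinjective (P : Contramodule k G) : Prop :=
  ∃ V : ModuleCat.{u} k, Nonempty (Retract P (homContra (leftReg k G) (leftReg_smooth k G) V))

/-- A smooth module is weakly compactly injective if it is injective as a discrete `H`-module for
some compact open subgroup `H`. -/
def IsWeaklyCompactlyInjective (M : SmoothMod k G) : Prop :=
  ∃ H : Subgroup G, IsOpen (H : Set G) ∧ IsCompact (H : Set G) ∧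
    Injective ((SmoothMod.res k H).obj M)

/-- A contramodule is weakly compactly projective if it is projective as an `H`-contramodule for
some compact open subgroup `H`. -/
def IsWeaklyCompactlyProjective (P : Contramodule k G) : Prop :=
  ∃ H : Subgroup G, IsOpen (H : Set G) ∧ IsCompact (H : Set G) ∧
    Projective ((Contramodule.res k H).obj P)

end Functors

/-- The functors `F : C ⥤ D` and `F' : D ⥤ C` restrict to mutually inverse equivalences between the
full subcategory of objects satisfying `p` and the full subcategory of objects satisfying `q`. -/
def RestrictToEquivalence {C D : Type*} [Category C] [Category D] (F : C ⥤ D) (F' : D ⥤ C)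
    (p : ObjectProperty C) (q : ObjectProperty D) : Prop :=
  ∃ (h : ∀ X, p X → q (F.obj X)) (h' : ∀ Y, q Y → p (F'.obj Y))
    (e : p.FullSubcategory ≌ q.FullSubcategory),
    e.functor = q.lift (p.ι ⋙ F) (fun X => h X.obj X.property) ∧
    e.inverse = p.lift (q.ι ⋙ F') (fun Y => h' Y.obj Y.property)

end

end LocProf

open LocProf

set_option linter.unusedSectionVars false

namespace LocProf

noncomputable section

section

/-! ### Adjunctions, retracts and restricted equivalences -/

section Formal

variable {C : Type*} {D : Type*} [Category C] [Category D]

/-! `Phi k G` is left adjoint to `Psi k G` (`phiPsiAdj`), with counit the evaluation `s ⊗ φ ↦ φ(s)`.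
An adjunction restricts to an equivalence wherever unit and counit are invertible. By the triangle
identity, invertibility of the counit at `M` gives invertibility of the unit at `Ψ(M)`, and both
properties pass to retracts. So it suffices to treat one generating family of smooth modules in each
half: the cofree modules `cofreeSmooth k G V` for (a), the modules `S ⊗ V` for (b).

The heart is `isIso_counit_of_cofreeOn`: the counit at `M` is invertible as soon as `M` is cofree
over every compact open subgroup `H`, that is, looks like locally constant functions from `H` to
some vector space `E`. Both families have this property, because `G` is a disjoint union of cosets
of `H`. Under it, `φ ↦ (A ↦ e(φ(1_A)))` identifies `Ψ(M)` over `H` with the free `H`-contramodule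
`E[[H]]` (`CofreeOn.pi_meas`, `CofreeOn.meas_pi`). Every element of `Φ(P)` has the form `1_K ⊗ x`
for small `K`, and `1_K ⊗ π(μ) = 1_K ⊗ μ(K)` for measures on `K`; these two facts reduce the counit
to a computation with `E[[K]]`.

For (a), every smooth module embeds in a cofree one, which is injective over `G` and over every open
subgroup. Hence injectives are the retracts of cofree modules. A Frobenius reciprocity isomorphism
`Ψ(cofree on V) ≅ Hom_k(S, V)` (`psiCofreeIso`) turns their images into the semiinjectives.

For (b), `Ψ(S ⊗ V)` is the free `G`-contramodule on `V` (`exists_projObj_lift`, `projObj_ext`). Over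
a compact open `H` it is free on copies of `V` indexed by `G ⧸ H`, which gives an `H`-linear
extension of any linear map on `V`; comparing it with its conjugates over smaller subgroups shows
that it is `G`-linear. Hence projectives are the retracts of the `Ψ(S ⊗ V)`, they remain projective
over `H`, and `Φ` carries them to the retracts of `S ⊗ V`. -/

theorem isIso_app_of_retract {F G : C ⥤ D} (η : F ⟶ G) {X Y : C} (h : Retract X Y)
    [IsIso (η.app Y)] : IsIso (η.app X) := by
  refine ⟨G.map h.i ≫ inv (η.app Y) ≫ F.map h.r, ?_, ?_⟩
  · rw [← η.naturality_assoc, IsIso.hom_inv_id_assoc, ← F.map_comp, h.retract, F.map_id]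
  · rw [Category.assoc, Category.assoc, η.naturality, IsIso.inv_hom_id_assoc, ← G.map_comp,
      h.retract, G.map_id]

/-- By the triangle identity, the unit at `G.obj Y` is a one-sided inverse of the image of an
invertible counit. -/
theorem isIso_unit_of_isIso_counit {F : C ⥤ D} {G : D ⥤ C} (adj : F ⊣ G) (Y : D)
    [IsIso (adj.counit.app Y)] : IsIso (adj.unit.app (G.obj Y)) := by
  have h := adj.right_triangle_components Y
  have : IsIso (adj.unit.app (G.obj Y) ≫ G.map (adj.counit.app Y)) := by
    rw [h]
    exact IsIso.id _
  exact IsIso.of_isIso_comp_right _ (G.map (adj.counit.app Y))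

/-- The components of the unit and the counit serve as the natural isomorphisms of the restricted
equivalence. The next result is the mirror image, with their inverses. -/
theorem restrictToEquivalence_left {F : C ⥤ D} {G : D ⥤ C} (adj : F ⊣ G)
    (p : ObjectProperty C) (q : ObjectProperty D) (hp : ∀ X, p X → q (F.obj X))
    (hq : ∀ Y, q Y → p (G.obj Y)) (hunit : ∀ X, p X → IsIso (adj.unit.app X))
    (hcounit : ∀ Y, q Y → IsIso (adj.counit.app Y)) : RestrictToEquivalence F G p q :=
  ⟨hp, hq, CategoryTheory.Equivalence.mk (q.lift (p.ι ⋙ F) fun X => hp X.obj X.property)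
    (p.lift (q.ι ⋙ G) fun Y => hq Y.obj Y.property)
    (NatIso.ofComponents (fun X => p.isoMk (@asIso _ _ _ _ _ (hunit X.obj X.property)))
      fun f => ObjectProperty.hom_ext _ (adj.unit.naturality f.hom))
    (NatIso.ofComponents (fun Y => q.isoMk (@asIso _ _ _ _ _ (hcounit Y.obj Y.property)))
      fun f => ObjectProperty.hom_ext _ (adj.counit.naturality f.hom)), rfl, rfl⟩

theorem restrictToEquivalence_right {F : C ⥤ D} {G : D ⥤ C} (adj : F ⊣ G)
    (p : ObjectProperty C) (q : ObjectProperty D) (hp : ∀ X, p X → q (F.obj X))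
    (hq : ∀ Y, q Y → p (G.obj Y)) (hunit : ∀ X, p X → IsIso (adj.unit.app X))
    (hcounit : ∀ Y, q Y → IsIso (adj.counit.app Y)) : RestrictToEquivalence G F q p :=
  ⟨hq, hp, CategoryTheory.Equivalence.mk (p.lift (q.ι ⋙ G) fun Y => hq Y.obj Y.property)
    (q.lift (p.ι ⋙ F) fun X => hp X.obj X.property)
    (NatIso.ofComponents (fun Y => q.isoMk (@asIso _ _ _ _ _ (hcounit Y.obj Y.property)).symm)
      fun {X Y} f => by
        have := hcounit X.obj X.property
        have := hcounit Y.obj Y.property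
        refine ObjectProperty.hom_ext _ ?_
        change f.hom ≫ inv (adj.counit.app Y.obj) =
          inv (adj.counit.app X.obj) ≫ F.map (G.map f.hom)
        rw [IsIso.eq_inv_comp, ← Category.assoc, IsIso.comp_inv_eq]
        exact (adj.counit.naturality f.hom).symm)
    (NatIso.ofComponents (fun X => p.isoMk (@asIso _ _ _ _ _ (hunit X.obj X.property)).symm)
      fun {X Y} f => by
        have := hunit X.obj X.property
        have := hunit Y.obj Y.property
        refine ObjectProperty.hom_ext _ ?_
        change G.map (F.map f.hom) ≫ inv (adj.unit.app Y.obj) =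
          inv (adj.unit.app X.obj) ≫ f.hom
        rw [IsIso.eq_inv_comp, ← Category.assoc, IsIso.comp_inv_eq]
        exact (adj.unit.naturality f.hom).symm), rfl, rfl⟩

end Formal

variable {k G : Type u} [Field k] [Group G] [TopologicalSpace G] [IsTopologicalGroup G]

/-! ### Morphisms of smooth modules -/

namespace SmoothMod

/-- The linear map underlying a morphism of smooth modules. -/
abbrev lin {M N : SmoothMod k G} (f : M ⟶ N) : M.obj.V →ₗ[k] N.obj.V := f.hom.hom.toLinearMap

/-- An equivariant linear map, as a morphism of smooth modules. -/
def ofLin {M N : SmoothMod k G} (f : M.obj.V →ₗ[k] N.obj.V)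
    (hf : ∀ g x, f (M.obj.ρ g x) = N.obj.ρ g (f x)) : M ⟶ N :=
  ObjectProperty.homMk (Rep.ofHom ⟨f, fun g => LinearMap.ext (hf g)⟩)

@[simp] theorem lin_ofLin {M N : SmoothMod k G} (f : M.obj.V →ₗ[k] N.obj.V)
    (hf : ∀ g x, f (M.obj.ρ g x) = N.obj.ρ g (f x)) : lin (ofLin f hf) = f := rfl

theorem lin_comm {M N : SmoothMod k G} (f : M ⟶ N) (g : G) (x : M.obj.V) :
    lin f (M.obj.ρ g x) = N.obj.ρ g (lin f x) := Rep.hom_comm_apply f.hom g x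

theorem hom_ext {M N : SmoothMod k G} {f g : M ⟶ N} (h : lin f = lin g) : f = g :=
  ObjectProperty.hom_ext _ (Rep.hom_ext (Representation.IntertwiningMap.ext h))

theorem isIso_of_bijective {M N : SmoothMod k G} (f : M ⟶ N) (h : Function.Bijective (lin f)) :
    IsIso f := by
  let e := LinearEquiv.ofBijective (lin f) h
  have he : ∀ x, lin f (e.symm x) = x := e.apply_symm_apply
  refine ⟨ofLin (e.symm : N.obj.V →ₗ[k] M.obj.V) (fun g x => h.1 ?_), hom_ext ?_, hom_ext ?_⟩
  · change lin f (e.symm _) = lin f (_)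
    rw [he, lin_comm]
    exact congrArg _ (he x).symm
  · exact LinearMap.ext e.symm_apply_apply
  · exact LinearMap.ext e.apply_symm_apply

/-- The kernel is itself a smooth module; its inclusion and the zero map become equal after
composition with the monomorphism. -/
theorem injective_of_mono {M N : SmoothMod k G} (f : M ⟶ N) [Mono f] :
    Function.Injective (lin f) := by
  let K : Submodule k M.obj.V := LinearMap.ker (lin f)
  have hK : ∀ g, ∀ x ∈ K, M.obj.ρ g x ∈ K := fun g x hx => by
    rw [LinearMap.mem_ker, lin_comm, LinearMap.mem_ker.1 hx, map_zero]
  let ρ : Representation k G K :=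
    { toFun := fun g => (M.obj.ρ g).restrict (hK g)
      map_one' := by ext x; simp
      map_mul' := fun g h => by ext x; simp }
  let K' : SmoothMod k G := ⟨Rep.of ρ, fun x => by
    have := M.property x.1
    convert this using 1
    ext g
    exact Subtype.ext_iff⟩
  have h : ofLin (M := K') (N := M) K.subtype (fun _ _ => rfl) = ofLin 0 (fun _ _ => by simp) := by
    rw [← cancel_mono f]
    exact hom_ext (LinearMap.ext fun x => x.2.trans (map_zero (lin f)).symm)
  rw [← LinearMap.ker_eq_bot, Submodule.eq_bot_iff]
  intro x hx
  exact LinearMap.congr_fun (congrArg lin h) (⟨x, hx⟩ : K)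

end SmoothMod

/-! ### The adjunction between contratensor product and Hom -/

section Adj

section Contratensor

variable {N : Type u} [AddCommGroup N] [Module k N] {ρ : Representation k G N} {hρ : IsSmooth ρ}

/-- The canonical bilinear map to the contratensor product. -/
def Contratensor.mk (hρ : IsSmooth ρ) (P : Contramodule k G) :
    N →ₗ[k] P.carrier →ₗ[k] Contratensor ρ hρ P :=
  (TensorProduct.mk k N P.carrier).compr₂ (LinearMap.range (contraDiff ρ hρ P)).mkQ

theorem Contratensor.mk_pi (P : Contramodule k G) (s : N) (μ : Meas k G P.carrier) :
    mk hρ P s (P.π μ) = actInteg ρ hρ (mk hρ P) s μ := by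
  refine Eq.trans ?_ (actInteg_comp ρ hρ _ (LinearMap.range (contraDiff ρ hρ P)).mkQ s μ)
  exact (Submodule.Quotient.eq _).2 ⟨s ⊗ₜ[k] μ, rfl⟩

theorem Contratensor.induction {P : Contramodule k G} {p : Contratensor ρ hρ P → Prop}
    (zero : p 0) (add : ∀ x y, p x → p y → p (x + y)) (mk : ∀ s x, p (Contratensor.mk hρ P s x))
    (x : Contratensor ρ hρ P) : p x := by
  obtain ⟨t, rfl⟩ := Submodule.mkQ_surjective _ x
  induction t with
  | zero => rw [map_zero]; exact zero
  | add s t hs ht => rw [map_add]; exact add _ _ hs ht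
  | tmul s x => exact mk s x

theorem Contratensor.linear_ext {P : Contramodule k G} {M : Type*} [AddCommGroup M] [Module k M]
    {f g : Contratensor ρ hρ P →ₗ[k] M} (h : ∀ s x, f (mk hρ P s x) = g (mk hρ P s x)) : f = g :=
  LinearMap.ext fun x => Contratensor.induction (p := fun x => f x = g x)
    (by rw [map_zero, map_zero]) (fun x y hx hy => by rw [map_add, map_add, hx, hy]) h x

/-- The linear map out of the contratensor product determined by a balanced bilinear map. -/
def Contratensor.lift {M : Type*} [AddCommGroup M] [Module k M] (hρ : IsSmooth ρ)
    (P : Contramodule k G) (B : N →ₗ[k] P.carrier →ₗ[k] M)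
    (hB : ∀ s μ, B s (P.π μ) = actInteg ρ hρ B s μ) : Contratensor ρ hρ P →ₗ[k] M :=
  Submodule.liftQ _ (TensorProduct.lift B) (by
    rintro _ ⟨t, rfl⟩
    rw [LinearMap.mem_ker]
    induction t with
    | zero => simp
    | add s t hs ht => rw [map_add, map_add, hs, ht, add_zero]
    | tmul s μ =>
      rw [contraDiff, LinearMap.sub_apply, map_sub, sub_eq_zero]
      refine (hB s μ).trans ?_
      exact (actInteg_comp ρ hρ (TensorProduct.mk k N P.carrier) (TensorProduct.lift B) s μ).symm)

end Contratensor

/-- The contratensor product of `S` and `P`, formed with respect to right translations. -/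
abbrev PhiCarrier (P : Contramodule k G) : Type u :=
  Contratensor (rightReg k G) (rightReg_smooth k G) P

/-- The canonical bilinear map to the contratensor product of `S` and `P`. -/
abbrev phiMk (P : Contramodule k G) : Fn k G →ₗ[k] P.carrier →ₗ[k] PhiCarrier P :=
  Contratensor.mk (rightReg_smooth k G) P

/-- The morphism to `Hom_{k[G]}(S, M)` corresponding to a morphism from `Φ_G(P)` to `M`. -/
def phiPsiCurry (P : Contramodule k G) (M : SmoothMod k G) (f : (Phi k G).obj P ⟶ M) :
    Contramodule.Hom P (psiObj M.obj.ρ) where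
  lin := LinearMap.codRestrict (equivHom M.obj.ρ) ((phiMk P).compr₂ (SmoothMod.lin f)).flip
    fun p g s => SmoothMod.lin_comm f g (phiMk P s p)
  comm μ := Subtype.ext (LinearMap.ext fun s =>
    (congrArg (SmoothMod.lin f) (Contratensor.mk_pi P s μ)).trans
      (actInteg_comp (rightReg k G) (rightReg_smooth k G) (phiMk P) (SmoothMod.lin f) s μ))

/-- The morphism from `Φ_G(P)` to `M` corresponding to a morphism to `Hom_{k[G]}(S, M)`. -/
def phiPsiUncurry (P : Contramodule k G) (M : SmoothMod k G)
    (f : Contramodule.Hom P (psiObj M.obj.ρ)) : (Phi k G).obj P ⟶ M :=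
  SmoothMod.ofLin (M := (Phi k G).obj P)
    (Contratensor.lift (rightReg_smooth k G) P ((equivHom M.obj.ρ).subtype ∘ₗ f.lin).flip fun s μ =>
      congrArg (fun φ => (φ : equivHom M.obj.ρ).1 s) (f.comm μ))
    fun g x => by
      refine Contratensor.induction (p := fun x => Contratensor.lift _ P _ _ (phiRep P g x) =
        M.obj.ρ g (Contratensor.lift _ P _ _ x)) ?_ (fun x y hx hy => ?_) (fun s x => ?_) x
      · rw [map_zero, map_zero, map_zero]
      · rw [map_add, map_add, map_add, map_add, hx, hy]
      · exact (f.lin x).2 g s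

variable (k G) in
/-- The functor `Φ_G` is left adjoint to `Ψ_G`. -/
def phiPsiAdj : Phi k G ⊣ Psi k G :=
  Adjunction.mkOfHomEquiv
    { homEquiv := fun P M =>
        { toFun := phiPsiCurry P M
          invFun := phiPsiUncurry P M
          left_inv := fun _ => SmoothMod.hom_ext (Contratensor.linear_ext fun _ _ => rfl)
          right_inv := fun _ => rfl }
      homEquiv_naturality_left_symm := fun _ _ =>
        SmoothMod.hom_ext (Contratensor.linear_ext fun _ _ => rfl)
      homEquiv_naturality_right := fun _ _ => rfl }

/-- The counit corresponds to the identity of `Ψ(M)`, so it is evaluation. -/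
theorem phiPsiAdj_counit_mk (M : SmoothMod k G) (s : Fn k G) (φ : equivHom M.obj.ρ) :
    SmoothMod.lin ((phiPsiAdj k G).counit.app M) (phiMk (psiObj M.obj.ρ) s φ) = φ.1 s := by
  have h : (phiPsiAdj k G).counit.app M =
      phiPsiUncurry (psiObj M.obj.ρ) M ⟨LinearMap.id, fun _ => rfl⟩ := by
    simp only [phiPsiAdj, Adjunction.mkOfHomEquiv]
    rfl
  rw [h]
  rfl

end Adj

end

section

/-! ### Measures under linear maps of values -/

section Measures

variable {k : Type*} [Field k] {X Y Z : Type*} [TopologicalSpace X] [TopologicalSpace Y]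
  [TopologicalSpace Z] {V W U : Type*} [AddCommGroup V] [Module k V] [AddCommGroup W] [Module k W]
  [AddCommGroup U] [Module k U]

theorem Meas.ext {μ ν : Meas k X V} (h : ∀ A, μ.1 A = ν.1 A) : μ = ν := Subtype.ext (funext h)

@[simp] theorem Meas.push_apply (f : C(X, Y)) (μ : Meas k X V) (A : Clopens Y) :
    (Meas.push f μ).1 A = μ.1 (preim f A) := rfl

@[simp] theorem Meas.map_apply (φ : V →ₗ[k] W) (μ : Meas k X V) (A : Clopens X) :
    (Meas.map φ μ).1 A = φ (μ.1 A) := rfl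

theorem Meas.dirac_apply_of_mem {x : X} {A : Clopens X} (h : x ∈ A) (v : V) :
    (Meas.dirac (k := k) x v).1 A = v := if_pos h

theorem Meas.dirac_apply_of_notMem {x : X} {A : Clopens X} (h : x ∉ A) (v : V) :
    (Meas.dirac (k := k) x v).1 A = 0 := if_neg h

theorem Meas.map_dirac (φ : V →ₗ[k] W) (x : X) (v : V) :
    Meas.map φ (Meas.dirac x v) = Meas.dirac x (φ v) := by
  refine Meas.ext fun A => ?_
  by_cases h : x ∈ A
  · rw [Meas.map_apply, Meas.dirac_apply_of_mem h, Meas.dirac_apply_of_mem h]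
  · rw [Meas.map_apply, Meas.dirac_apply_of_notMem h, Meas.dirac_apply_of_notMem h, map_zero]

theorem Meas.map_map (φ : V →ₗ[k] W) (ψ : W →ₗ[k] U) (μ : Meas k X V) :
    Meas.map ψ (Meas.map φ μ) = Meas.map (ψ ∘ₗ φ) μ := rfl

theorem Meas.map_surjective (φ : V →ₗ[k] W) (h : Function.Surjective φ) :
    Function.Surjective (Meas.map (X := X) φ) := by
  obtain ⟨σ, hσ⟩ := φ.exists_rightInverse_of_surjective (LinearMap.range_eq_top.2 h)
  refine fun μ => ⟨Meas.map σ μ, ?_⟩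
  rw [Meas.map_map, hσ]
  rfl

/-- Over a field the range of `φ` is a direct summand of `W` and `φ` has a linear section over it.
Applying one linear map to all values keeps additivity and compact support. -/
theorem Meas.exists_map_eq (φ : V →ₗ[k] W) (μ : Meas k X W)
    (h : ∀ A, μ.1 A ∈ LinearMap.range φ) : ∃ ν : Meas k X V, Meas.map φ ν = μ := by
  obtain ⟨σ, hσ⟩ := φ.rangeRestrict.exists_rightInverse_of_surjective φ.range_rangeRestrict
  obtain ⟨π, hπ⟩ := (LinearMap.range φ).subtype.exists_leftInverse_of_injective
    (LinearMap.range φ).ker_subtype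
  refine ⟨Meas.map (σ ∘ₗ π) μ, Meas.ext fun A => ?_⟩
  have h1 : π (μ.1 A) = ⟨μ.1 A, h A⟩ := LinearMap.congr_fun hπ ⟨μ.1 A, h A⟩
  have h2 := congrArg Subtype.val (LinearMap.congr_fun hσ ⟨μ.1 A, h A⟩)
  change φ (σ (π (μ.1 A))) = μ.1 A
  rw [h1]
  exact h2

end Measures

variable {k G : Type u} [Field k] [Group G] [TopologicalSpace G] [IsTopologicalGroup G]

/-! ### Isomorphisms, epimorphisms and the right action of group elements on contramodules -/

namespace Contramodule

theorem hom_ext {P Q : Contramodule k G} {f g : P ⟶ Q} (h : Hom.lin f = Hom.lin g) : f = g :=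
  Hom.ext h

/-- A bijective morphism of contramodules is an isomorphism. -/
def isoOfBijective {P Q : Contramodule k G} (f : P ⟶ Q) (h : Function.Bijective (Hom.lin f)) :
    P ≅ Q where
  hom := f
  inv :=
    { lin := (LinearEquiv.ofBijective (Hom.lin f) h).symm
      comm := fun μ => h.1 (by
        let e := LinearEquiv.ofBijective (Hom.lin f) h
        have he : ∀ x, Hom.lin f (e.symm x) = x := e.apply_symm_apply
        refine (he _).trans ?_
        rw [f.comm, Meas.map_map]
        exact congrArg Q.π (Meas.ext fun A => (he _).symm)) }
  hom_inv_id := hom_ext (LinearMap.ext (LinearEquiv.ofBijective (Hom.lin f) h).symm_apply_apply)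
  inv_hom_id := hom_ext (LinearMap.ext (LinearEquiv.ofBijective (Hom.lin f) h).apply_symm_apply)

theorem epi_of_surjective {P Q : Contramodule k G} (f : P ⟶ Q)
    (h : Function.Surjective (Hom.lin f)) : Epi f where
  left_cancellation g g' hg := hom_ext (LinearMap.ext fun y => by
    obtain ⟨x, rfl⟩ := h y
    exact LinearMap.congr_fun (congrArg Hom.lin hg) x)

/-- Two lifts of the same quotient-valued measure differ by a measure with values in `E`. So the
contraaction defined through the section `σ` does not depend on the lift, and the axioms descend to
the quotient. -/
theorem mkQ_pi_map_section (P : Contramodule k G) (E : Submodule k P.carrier)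
    (hE : ∀ μ : Meas k G P.carrier, (∀ A, μ.1 A ∈ E) → P.π μ ∈ E)
    (σ : (P.carrier ⧸ E) →ₗ[k] P.carrier) (hσ : E.mkQ ∘ₗ σ = LinearMap.id)
    (μ : Meas k G P.carrier) :
    E.mkQ (P.π (Meas.map σ (Meas.map E.mkQ μ))) = E.mkQ (P.π μ) := by
  rw [← sub_eq_zero, ← map_sub, ← map_sub]
  refine (Submodule.Quotient.mk_eq_zero E).2 (hE _ fun A => ?_)
  refine (Submodule.Quotient.mk_eq_zero E).1 ?_
  change E.mkQ (σ (E.mkQ (μ.1 A)) - μ.1 A) = 0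
  rw [map_sub, sub_eq_zero]
  exact LinearMap.congr_fun hσ _

/-- The quotient of a contramodule by a subspace `E`, when `E` is closed under the contraaction. -/
def quotient (P : Contramodule k G) (E : Submodule k P.carrier)
    (hE : ∀ μ : Meas k G P.carrier, (∀ A, μ.1 A ∈ E) → P.π μ ∈ E)
    (σ : (P.carrier ⧸ E) →ₗ[k] P.carrier) (hσ : E.mkQ ∘ₗ σ = LinearMap.id) :
    Contramodule k G :=
  have key := P.mkQ_pi_map_section E hE σ hσ
  { carrier := P.carrier ⧸ E
    π := E.mkQ ∘ₗ P.π ∘ₗ Meas.map σ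
    assoc := fun μ => by
      obtain ⟨μ, rfl⟩ := Meas.map_surjective E.mkQ E.mkQ_surjective μ
      refine (key _).trans ((congrArg E.mkQ (P.assoc μ)).trans ?_)
      refine (key _).symm.trans (congrArg (E.mkQ ∘ₗ P.π ∘ₗ Meas.map σ) (Meas.ext fun B => ?_))
      exact (key ((Meas.curry μ).1 B)).symm
    unit := fun x => by
      obtain ⟨x, rfl⟩ := E.mkQ_surjective x
      rw [← Meas.map_dirac]
      exact (key _).trans (congrArg E.mkQ (P.unit x)) }

/-- The range is closed under the contraaction, since range-valued measures lift. Hence the cokernel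
exists as a contramodule, and its projection must agree with the zero map. -/
theorem surjective_of_epi {P Q : Contramodule k G} (f : P ⟶ Q) [Epi f] :
    Function.Surjective (Hom.lin f) := by
  let E : Submodule k Q.carrier := LinearMap.range (Hom.lin f)
  have hE : ∀ μ : Meas k G Q.carrier, (∀ A, μ.1 A ∈ E) → Q.π μ ∈ E := fun μ hμ => by
    obtain ⟨ν, rfl⟩ := Meas.exists_map_eq (Hom.lin f) μ hμ
    exact ⟨P.π ν, f.comm ν⟩
  obtain ⟨σ, hσ⟩ := E.mkQ.exists_rightInverse_of_surjective E.range_mkQ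
  let q : Q ⟶ Q.quotient E hE σ hσ :=
    { lin := E.mkQ
      comm := fun μ => (Q.mkQ_pi_map_section E hE σ hσ μ).symm }
  let z : Q ⟶ Q.quotient E hE σ hσ :=
    { lin := 0
      comm := fun μ => by
        have : Meas.map (0 : Q.carrier →ₗ[k] (Q.quotient E hE σ hσ).carrier) μ = 0 := rfl
        rw [this, map_zero]
        rfl }
  have h : q = z := by
    rw [← cancel_epi f]
    exact hom_ext (LinearMap.ext fun x => (Submodule.Quotient.mk_eq_zero E).2 ⟨x, rfl⟩)
  intro y
  exact (Submodule.Quotient.mk_eq_zero E).1 (LinearMap.congr_fun (congrArg Hom.lin h) y)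

/-- The right action of the elements of the group on a contramodule. -/
def act (P : Contramodule k G) (g : G) : P.carrier →ₗ[k] P.carrier := P.π ∘ₗ Meas.dirac g

/-- Associativity for the image of `μ` on `G × {g}`: currying it gives a point measure at `g` in the
second factor. This order of the factors makes the action of elements a right action. -/
theorem act_pi (P : Contramodule k G) (g : G) (μ : Meas k G P.carrier) :
    P.act g (P.π μ) = P.π (Meas.push ⟨fun x => x * g, continuous_mul_const g⟩ μ) := by
  have h := P.assoc (Meas.push ⟨fun x => (x, g), by fun_prop⟩ μ)
  refine Eq.trans (congrArg P.π (Meas.ext fun B => ?_)) h.symm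
  by_cases hB : g ∈ B
  · rw [Meas.dirac_apply_of_mem hB]
    refine congrArg P.π (Meas.ext fun A => congrArg μ.1 (Clopens.ext ?_))
    exact Set.ext fun x => ⟨fun hx => ⟨hx, hB⟩, fun hx => hx.1⟩
  · rw [Meas.dirac_apply_of_notMem hB]
    refine (map_zero P.π).symm.trans (congrArg P.π (Meas.ext fun A => ?_))
    exact (Meas.empty μ _ (Set.eq_empty_of_forall_notMem fun x (hx : x ∈ _ ∧ g ∈ B) => hB hx.2)).symm

/-- Associativity for the image of `μ` on `{g} × G`, where currying leaves point measures at `g` as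
values. -/
theorem pi_map_act (P : Contramodule k G) (g : G) (μ : Meas k G P.carrier) :
    P.π (Meas.map (P.act g) μ) = P.π (Meas.push ⟨fun x => g * x, continuous_const_mul g⟩ μ) := by
  have h := P.assoc (Meas.push ⟨fun x => (g, x), by fun_prop⟩ μ)
  refine Eq.trans (congrArg P.π (Meas.ext fun B => ?_)) h.symm
  refine congrArg P.π (Meas.ext fun A => ?_)
  by_cases hA : g ∈ A
  · rw [Meas.dirac_apply_of_mem hA]
    refine congrArg μ.1 (Clopens.ext ?_)
    exact Set.ext fun x => ⟨fun hx => ⟨hA, hx⟩, fun hx => hx.2⟩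
  · rw [Meas.dirac_apply_of_notMem hA]
    exact (Meas.empty μ _ (Set.eq_empty_of_forall_notMem fun x (hx : g ∈ A ∧ x ∈ B) => hA hx.1)).symm

theorem act_one (P : Contramodule k G) (x : P.carrier) : P.act 1 x = x := P.unit x

theorem act_act (P : Contramodule k G) (g h : G) (x : P.carrier) :
    P.act h (P.act g x) = P.act (g * h) x := P.act_pi h (Meas.dirac g x)

theorem hom_act {P Q : Contramodule k G} (f : Hom P Q) (g : G) (x : P.carrier) :
    f.lin (P.act g x) = Q.act g (f.lin x) :=
  (f.comm _).trans (congrArg Q.π (Meas.map_dirac _ _ _))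

end Contramodule

end

section

/-! ### Slices of open-closed sets in a product -/

section Slice

variable {k : Type*} [Field k] {X Y : Type*} [TopologicalSpace X] [TopologicalSpace Y]
  {V W : Type*} [AddCommGroup V] [Module k V] [AddCommGroup W] [Module k W]

theorem isLocallyConstant_mem {U : Set X} (hU : IsClopen U) : IsLocallyConstant fun x => x ∈ U := by
  rw [IsLocallyConstant.iff_exists_open]
  intro x
  by_cases hx : x ∈ U
  · exact ⟨U, hU.isOpen, hx, fun y hy => by simp [hx, hy]⟩
  · exact ⟨Uᶜ, hU.compl.isOpen, hx, fun y hy => eq_iff_iff.2 ⟨fun h => absurd h hy, fun h => absurd h hx⟩⟩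

/-- The slice of an open-closed subset of a product. -/
def slice (C : Clopens (X × Y)) (y : Y) : Clopens X := preim ⟨fun x => (x, y), by fun_prop⟩ C

/-- By the tube lemma, the open set of points where membership in `C` agrees with membership in the
slice at `y` contains a strip `X × T` around `X × {y}`, as `X` is compact. -/
theorem slice_isLocallyConstant [CompactSpace X] (C : Clopens (X × Y)) :
    IsLocallyConstant (slice C) := by
  rw [IsLocallyConstant.iff_exists_open]
  intro y
  have hD : IsOpen {p : X × Y | (p ∈ C) ↔ (p.1, y) ∈ C} := by
    have h1 : IsLocallyConstant fun p : X × Y => p ∈ C := isLocallyConstant_mem C.isClopen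
    have h2 : IsLocallyConstant fun p : X × Y => (p.1, y) ∈ C :=
      h1.comp_continuous (f := fun p : X × Y => (p.1, y)) (by fun_prop)
    have h3 := (h1.prodMk h2) {q | q.1 ↔ q.2}
    exact h3
  obtain ⟨U, T, -, hT, hU, hyT, hUT⟩ := generalized_tube_lemma (isCompact_univ (X := X))
    (isCompact_singleton (x := y)) hD (by
      rintro ⟨x, y'⟩ ⟨-, hy⟩
      obtain rfl : y' = y := hy
      exact Iff.rfl)
  refine ⟨T, hT, hyT rfl, fun z hz => Clopens.ext (Set.ext fun x => ?_)⟩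
  exact hUT (Set.mk_mem_prod (hU (Set.mem_univ x)) hz)

end Slice

/-! ### Compact open subgroups and their indicator functions -/

variable {k G : Type u} [Field k] [Group G] [TopologicalSpace G] [IsTopologicalGroup G]

/-- A subgroup which is open and compact. -/
class CompactOpen (H : Subgroup G) : Prop where
  isOpen : IsOpen (H : Set G)
  isCompact : IsCompact (H : Set G)

instance (H : Subgroup G) [h : CompactOpen H] : CompactSpace H :=
  isCompact_iff_compactSpace.1 h.isCompact

theorem CompactOpen.isClopen_image (H : Subgroup G) [h : CompactOpen H] (A : Clopens H) :
    IsClopen (((↑) : H → G) '' A) :=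
  ⟨(Subgroup.isClosed_of_isOpen H h.isOpen).isClosedEmbedding_subtypeVal.isClosedMap _
    A.isClopen.isClosed, h.isOpen.isOpenMap_subtype_val _ A.isClopen.isOpen⟩

/-- The indicator function of an open compact set. -/
def indicatorFn (k : Type u) [Field k] (U : Set G) (hU : IsClopen U) (hc : IsCompact U) : Fn k G :=
  ⟨U.indicator 1, by
    classical
    convert (isLocallyConstant_mem hU).comp fun p : Prop => if p then (1 : k) else 0
    ext x
    simp [Set.indicator_apply],
    HasCompactSupport.of_support_subset_isCompact hc Set.support_indicator_subset⟩

variable (k) in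
/-- The indicator function of an open-closed subset of a compact open subgroup. -/
def ind (H : Subgroup G) [CompactOpen H] (A : Clopens H) : Fn k G :=
  indicatorFn k (((↑) : H → G) '' A) (CompactOpen.isClopen_image H A)
    (A.isClopen.isClosed.isCompact.image continuous_subtype_val)

section Ind

variable (H : Subgroup G) [CompactOpen H]

theorem ind_apply_of_mem {A : Clopens H} {h : H} (hA : h ∈ A) : (ind k H A).1 h = 1 :=
  Set.indicator_of_mem (Set.mem_image_of_mem _ hA) _

theorem ind_apply_of_notMem {A : Clopens H} {h : H} (hA : h ∉ A) : (ind k H A).1 h = 0 :=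
  Set.indicator_of_notMem (by rintro ⟨y, h1, h2⟩; exact hA (Subtype.ext h2 ▸ h1)) _

theorem ind_apply_of_notMem_subgroup {A : Clopens H} {x : G} (hx : x ∉ H) : (ind k H A).1 x = 0 :=
  Set.indicator_of_notMem (by rintro ⟨h, -, h2⟩; exact hx (h2 ▸ h.2)) _

theorem ind_ext {A : Clopens H} {f : Fn k G} (h1 : ∀ h : H, h ∈ A → f.1 h = 1)
    (h2 : ∀ h : H, h ∉ A → f.1 h = 0) (h3 : ∀ x, x ∉ H → f.1 x = 0) : f = ind k H A := by
  refine Subtype.ext (funext fun x => ?_)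
  by_cases hx : x ∈ H
  · by_cases hA : (⟨x, hx⟩ : H) ∈ A
    · exact (h1 _ hA).trans (ind_apply_of_mem H hA).symm
    · exact (h2 _ hA).trans (ind_apply_of_notMem H hA).symm
  · exact (h3 x hx).trans (ind_apply_of_notMem_subgroup H hx).symm

theorem ind_of_eq_empty (A : Clopens H) (hA : (A : Set H) = ∅) : ind k H A = 0 :=
  (ind_ext H (fun h hh => absurd hh (Set.eq_empty_iff_forall_notMem.1 hA h)) (fun _ _ => rfl)
    fun _ _ => rfl).symm

theorem ind_sup (A B : Clopens H) (h : Disjoint (A : Set H) B) :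
    ind k H (A ⊔ B) = ind k H A + ind k H B := by
  refine (ind_ext H (fun x hx => ?_) (fun x hx => ?_) fun x hx => ?_).symm
  · change (ind k H A).1 x + (ind k H B).1 x = 1
    rcases hx with hx | hx
    · rw [ind_apply_of_mem H hx, ind_apply_of_notMem H (Set.disjoint_left.1 h hx), add_zero]
    · rw [ind_apply_of_notMem H (Set.disjoint_right.1 h hx), ind_apply_of_mem H hx, zero_add]
  · change (ind k H A).1 x + (ind k H B).1 x = 0
    rw [ind_apply_of_notMem H fun h' => hx (Or.inl h'),
      ind_apply_of_notMem H fun h' => hx (Or.inr h'), add_zero]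
  · change (ind k H A).1 x + (ind k H B).1 x = 0
    rw [ind_apply_of_notMem_subgroup H hx, ind_apply_of_notMem_subgroup H hx, add_zero]

/-- The multiplication of a subgroup. -/
abbrev mulMap (H : Subgroup G) : C(H × H, H) := ⟨fun p => p.1 * p.2, continuous_mul⟩

theorem rightReg_ind (h : H) (A : Clopens H) :
    rightReg k G h (ind k H A) = ind k H (slice (preim (mulMap H) A) h) :=
  ind_ext H (fun x hx => ind_apply_of_mem H (h := x * h) hx)
    (fun x hx => ind_apply_of_notMem H (h := x * h) hx)
    fun _ hx => ind_apply_of_notMem_subgroup H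
      fun h' => hx ((Subgroup.mul_mem_cancel_right H h.2).1 h')

theorem rightReg_ind_top (h : H) : rightReg k G h (ind k H ⊤) = ind k H ⊤ := by
  rw [rightReg_ind]
  rfl

theorem leftReg_ind (h : H) (A : Clopens H) :
    leftReg k G h (ind k H A) = ind k H (preim ⟨fun x => h⁻¹ * x, by fun_prop⟩ A) :=
  ind_ext H (fun x hx => ind_apply_of_mem H (h := h⁻¹ * x) hx)
    (fun x hx => ind_apply_of_notMem H (h := h⁻¹ * x) hx)
    fun _ hx => ind_apply_of_notMem_subgroup H
      fun h' => hx ((Subgroup.mul_mem_cancel_left H (H.inv_mem h.2)).1 h')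

/-- The translate is the indicator function of the coset `gK`, an open-closed subset of `H`. -/
theorem exists_ind_eq_of_le {K : Subgroup G} [hK : CompactOpen K] (h : K ≤ H) (g : H) :
    ∃ A : Clopens H, leftReg k G g (ind k K ⊤) = ind k H A := by
  let A : Clopens H := ⟨(fun x : H => (x : G)) ⁻¹' (K : Set G),
    IsClopen.preimage ⟨Subgroup.isClosed_of_isOpen K hK.isOpen, hK.isOpen⟩
      continuous_subtype_val⟩
  have hA : ind k K ⊤ = ind k H A := ind_ext H
    (fun x hx => ind_apply_of_mem K (h := ⟨x, hx⟩) (A := ⊤) (Set.mem_univ _))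
    (fun _ hx => ind_apply_of_notMem_subgroup K hx)
    fun x hx => ind_apply_of_notMem_subgroup K fun h' => hx (h h')
  exact ⟨_, by rw [hA, leftReg_ind]⟩

end Ind

/-- Van Dantzig's theorem: take the stabilizer, under right translations, of the indicator function
of a compact open-closed neighbourhood `W` of `1` inside `U`. It is open because right translations
act smoothly, and it lies in `W` because a stabilizing `g` gives the function the same value at `g`
as at `1`. -/
theorem exists_compactOpen_subset [T2Space G] [LocallyCompactSpace G] [TotallyDisconnectedSpace G]
    {U : Set G} (hU : U ∈ nhds (1 : G)) : ∃ K : Subgroup G, CompactOpen K ∧ (K : Set G) ⊆ U := by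
  obtain ⟨L, hL, hLU, hLc⟩ := local_compact_nhds hU
  obtain ⟨W, hW, h1W, hWL⟩ := loc_compact_Haus_tot_disc_of_zero_dim.mem_nhds_iff.1 hL
  have hWc : IsCompact W := hLc.of_isClosed_subset hW.isClosed hWL
  -- The coefficient field is immaterial; `ℚ` is lifted only to match the universe of `G`.
  let f : Fn (ULift.{u} ℚ) G := indicatorFn _ W hW hWc
  let K : Subgroup G :=
    { carrier := {g | rightReg (ULift.{u} ℚ) G g f = f}
      one_mem' := by simp
      mul_mem' := fun {a b} (ha : _ = _) (hb : _ = _) => by simp [ha, hb]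
      inv_mem' := fun {a} (ha : _ = _) => by
        change rightReg (ULift.{u} ℚ) G a⁻¹ f = f
        conv_lhs => rw [← ha]
        simp }
  have hK : IsOpen (K : Set G) := rightReg_smooth (ULift.{u} ℚ) G f
  have hKW : (K : Set G) ⊆ W := fun g (hg : _ = _) => by
    by_contra hgW
    have h1 : f.1 (1 * g) = f.1 1 := congrFun (congrArg Subtype.val hg) 1
    have h2 : f.1 (1 * g) = 0 := Set.indicator_of_notMem (by rwa [one_mul]) _
    have h3 : f.1 1 = 1 := Set.indicator_of_mem h1W _
    rw [h2, h3] at h1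
    exact zero_ne_one h1
  exact ⟨K, ⟨hK, hWc.of_isClosed_subset (Subgroup.isClosed_of_isOpen K hK) hKW⟩,
    hKW.trans (hWL.trans hLU)⟩

/-! ### Functions as combinations of translated indicator functions -/

section Inversion

/-- Composition of functions with the inversion of the group. -/
def invFn : Fn k G →ₗ[k] Fn k G where
  toFun f := ⟨fun x => f.1 x⁻¹, f.2.1.comp_continuous continuous_inv,
    f.2.2.comp_homeomorph (Homeomorph.inv G)⟩
  map_add' _ _ := rfl
  map_smul' _ _ := rfl

@[simp] theorem invFn_invFn (f : Fn k G) : invFn (invFn f) = f := by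
  ext x
  exact congrArg f.1 (inv_inv x)

theorem invFn_leftReg (g : G) (f : Fn k G) :
    invFn (leftReg k G g f) = rightReg k G g (invFn f) := by
  ext x
  exact congrArg f.1 (by group)

theorem invFn_ind_top (H : Subgroup G) [CompactOpen H] : invFn (ind k H ⊤) = ind k H ⊤ :=
  ind_ext H (fun h _ => ind_apply_of_mem H (h := h⁻¹) (A := ⊤) (Set.mem_univ _))
    (fun h hh => absurd (Set.mem_univ h) hh)
    fun _ hx => ind_apply_of_notMem_subgroup H fun h' => hx (H.inv_mem_iff.1 h')

theorem leftCoset_isLocallyConstant (K : Subgroup G) [hK : CompactOpen K] :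
    IsLocallyConstant fun x : G => (x : G ⧸ K) := by
  rw [IsLocallyConstant.iff_exists_open]
  intro x
  refine ⟨(fun y => x⁻¹ * y) ⁻¹' K, hK.isOpen.preimage (by fun_prop), ?_, fun y hy => ?_⟩
  · simp
  · exact (QuotientGroup.eq.2 hy).symm

/-- A right `K`-invariant function is constant on each coset `qK`, and its compact support meets
only finitely many of them, so it is a finite sum of multiples of the `1_{qK}`. -/
theorem mem_span_leftReg (K : Subgroup G) [CompactOpen K] (f : Fn k G)
    (hf : ∀ h ∈ K, rightReg k G h f = f) :
    f ∈ Submodule.span k (Set.range fun g => leftReg k G g (ind k K ⊤)) := by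
  classical
  have hfin := image_finite _ (leftCoset_isLocallyConstant K) (tsupport f.1) f.2.2
  have hval : ∀ x : G, f.1 (Quotient.out (x : G ⧸ K)) = f.1 x := fun x => by
    obtain ⟨h, hh⟩ := QuotientGroup.mk_out_eq_mul K x
    rw [hh]
    exact congrFun (congrArg Subtype.val (hf h h.2)) x
  have hind : ∀ (q : G ⧸ K) (x : G),
      (leftReg k G q.out (ind k K ⊤)).1 x = if (x : G ⧸ K) = q then 1 else 0 := fun q x => by
    have hq : (x : G ⧸ K) = q ↔ q.out⁻¹ * x ∈ K := by
      rw [← QuotientGroup.eq, QuotientGroup.out_eq', eq_comm]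
    split_ifs with h
    · exact ind_apply_of_mem K (h := ⟨_, hq.1 h⟩) (A := ⊤) (Set.mem_univ _)
    · exact ind_apply_of_notMem_subgroup K fun h' => h (hq.2 h')
  have h : f = ∑ q ∈ hfin.toFinset, f.1 q.out • leftReg k G q.out (ind k K ⊤) := by
    refine Subtype.ext (funext fun x => ?_)
    have hsum : (∑ q ∈ hfin.toFinset, f.1 q.out • leftReg k G q.out (ind k K ⊤)).1 x =
        ∑ q ∈ hfin.toFinset, f.1 q.out * if (x : G ⧸ K) = q then 1 else 0 := by
      rw [Submodule.coe_sum, Finset.sum_apply]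
      exact Finset.sum_congr rfl fun q _ => congrArg (f.1 q.out * ·) (hind q x)
    rw [hsum]
    by_cases hx : x ∈ tsupport f.1
    · rw [Finset.sum_eq_single (x : G ⧸ K)]
      · rw [if_pos rfl, mul_one, hval]
      · intro q _ hq
        rw [if_neg hq.symm, mul_zero]
      · intro hx'
        exact absurd (hfin.mem_toFinset.2 ⟨x, hx, rfl⟩) hx'
    · rw [image_eq_zero_of_notMem_tsupport hx, Finset.sum_eq_zero]
      intro q _
      split_ifs with hq
      · rw [← hq, hval, image_eq_zero_of_notMem_tsupport hx, zero_mul]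
      · rw [mul_zero]
  rw [h]
  exact Submodule.sum_mem _ fun q _ => Submodule.smul_mem _ _ (Submodule.subset_span ⟨_, rfl⟩)

/-- Inversion exchanges left and right translations and fixes `1_K`. -/
theorem mem_span_rightReg (K : Subgroup G) [CompactOpen K] (f : Fn k G)
    (hf : ∀ h ∈ K, leftReg k G h f = f) :
    f ∈ Submodule.span k (Set.range fun g => rightReg k G g (ind k K ⊤)) := by
  have h := Submodule.mem_map_of_mem (f := invFn) (mem_span_leftReg K (invFn f) fun h hh => by
    rw [← invFn_leftReg, hf h hh])
  rw [invFn_invFn, Submodule.map_span] at h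
  refine Submodule.span_mono ?_ h
  rintro _ ⟨_, ⟨g, rfl⟩, rfl⟩
  exact ⟨g, by rw [invFn_leftReg, invFn_ind_top]⟩

end Inversion

end

/-! ### The counit at modules that are cofree over compact open subgroups -/

section

theorem integ_congr {k X A V W : Type*} [Field k] [TopologicalSpace X] [AddCommGroup V] [Module k V]
    [AddCommGroup W] [Module k W] {f f' : X → A} (h : f = f') (hf : IsLocallyConstant f)
    (hf' : IsLocallyConstant f') (F : A → V →ₗ[k] W) : integ f hf F = integ f' hf' F := by
  subst h
  rfl

theorem integ_mem {k X V W : Type*} [Field k] [TopologicalSpace X] [AddCommGroup V] [Module k V]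
    [AddCommGroup W] [Module k W] (A : Clopens X) (hf : IsLocallyConstant fun x => x ∈ A)
    (F : Prop → V →ₗ[k] W) (h0 : F False = 0) (μ : Meas k X V) :
    integ _ hf F μ = F True (μ.1 A) := by
  rw [integ_apply, finsum_eq_single _ True]
  · refine congrArg (fun A => F True (μ.1 A)) (Clopens.ext (Set.ext fun x => ?_))
    change ((x ∈ A) = True) ↔ x ∈ A
    simp
  · intro p hp
    obtain rfl : p = False := by simpa using hp
    rw [h0]
    rfl

variable {k G : Type u} [Field k] [Group G] [TopologicalSpace G] [IsTopologicalGroup G]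

section

variable (H : Subgroup G) [CompactOpen H]

/-- The defining relation of the contratensor product, applied to a point measure. -/
theorem phiMk_rightReg (P : Contramodule k G) (g : G) (s : Fn k G) (x : P.carrier) :
    phiMk P (rightReg k G g s) x = phiMk P s (P.act g x) :=
  (actInteg_dirac (rightReg k G) (rightReg_smooth k G) (phiMk P) s g x).symm.trans
    (Contratensor.mk_pi P s (Meas.dirac g x)).symm

/-- The function `1_H` is invariant under right translations by `H`, so the integral of `1_H h ⊗
dμ_h` collapses to `1_H ⊗ μ(H)`. -/
theorem phiMk_ind_top_pi (P : Contramodule k G) (μ : Meas k H P.carrier) :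
    phiMk P (ind k H ⊤) (P.π (Meas.push (incl H) μ)) = phiMk P (ind k H ⊤) (μ.1 ⊤) := by
  have hfib : ∀ (n : Fn k G) (h : H), h ∈ preim (incl H) (fib
      (fun g => rightReg k G g (ind k H ⊤)) ((rightReg_smooth k G).orbit _) n) ↔ ind k H ⊤ = n :=
    fun n h => by
      change rightReg k G h (ind k H ⊤) = n ↔ ind k H ⊤ = n
      rw [rightReg_ind_top]
  refine (Contratensor.mk_pi P _ _).trans ?_
  rw [actInteg_apply, finsum_eq_single _ (ind k H ⊤)]
  · refine congrArg (fun A => phiMk P (ind k H ⊤) (μ.1 A)) (Clopens.ext (Set.ext fun h => ?_))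
    exact (hfib _ h).trans (iff_of_true rfl (Set.mem_univ h))
  · intro n hn
    rw [Meas.push_apply, Meas.empty μ _ (Set.eq_empty_of_forall_notMem fun h hh =>
      hn ((hfib n h).1 hh).symm), map_zero]

/-- A function that is left invariant under `K` is a combination of right translates of `1_K`, and
these translations move across the tensor sign. Asking for all sufficiently small `K` lets two
summands share the same subgroup. -/
theorem exists_eq_phiMk (P : Contramodule k G) (t : PhiCarrier P) :
    ∃ U ∈ nhds (1 : G), ∀ (K : Subgroup G) [CompactOpen K], (K : Set G) ⊆ U →
      ∃ x, t = phiMk P (ind k K ⊤) x := by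
  refine Contratensor.induction (p := fun t => ∃ U ∈ nhds (1 : G), ∀ (K : Subgroup G)
    [CompactOpen K], (K : Set G) ⊆ U → ∃ x, t = phiMk P (ind k K ⊤) x) ?_ ?_ ?_ t
  · exact ⟨Set.univ, Filter.univ_mem, fun K _ _ => ⟨0, by rw [map_zero]⟩⟩
  · rintro s t ⟨U, hU, hs⟩ ⟨W, hW, ht⟩
    refine ⟨U ∩ W, Filter.inter_mem hU hW, fun K _ hK => ?_⟩
    obtain ⟨x, rfl⟩ := hs K (hK.trans Set.inter_subset_left)
    obtain ⟨y, rfl⟩ := ht K (hK.trans Set.inter_subset_right)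
    exact ⟨x + y, by rw [map_add]⟩
  · intro s x
    refine ⟨_, (leftReg_smooth k G s).mem_nhds (by simp), fun K _ hK => ?_⟩
    have hs := mem_span_rightReg K s fun h hh => hK hh
    clear hK
    induction hs using Submodule.span_induction generalizing x with
    | mem s hs =>
      obtain ⟨g, rfl⟩ := hs
      exact ⟨_, phiMk_rightReg P g _ x⟩
    | zero => exact ⟨0, by rw [map_zero, map_zero, LinearMap.zero_apply]⟩
    | add s t _ _ hs ht =>
      obtain ⟨y, hy⟩ := hs x
      obtain ⟨z, hz⟩ := ht x
      exact ⟨y + z, by rw [map_add, map_add, LinearMap.add_apply, hy, hz]⟩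
    | smul c s _ hs =>
      obtain ⟨y, hy⟩ := hs x
      exact ⟨c • y, by rw [map_smul, map_smul, LinearMap.smul_apply, hy]⟩

variable {M : Type u} [AddCommGroup M] [Module k M] {ρ : Representation k G M}

/-- Right translation by `h` takes `1_A` to the indicator of `Ah⁻¹`, which is the slice at `h` of
the preimage of `A` under multiplication. The integral over translates thus becomes one over slices,
the form in which measures on `H × H` are built. -/
theorem psi_pi_ind (A : Clopens H) (μ : Meas k H (equivHom ρ)) :
    ((psiObj ρ).π (Meas.push (incl H) μ)).1 (ind k H A) =
      integ (slice (preim (mulMap H) A)) (slice_isLocallyConstant _)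
        (fun B => LinearMap.applyₗ (ind k H B) ∘ₗ (equivHom ρ).subtype) μ := by
  have hf : (fun h : H => rightReg k G h (ind k H A)) =
      ind k H ∘ slice (preim (mulMap H) A) := funext fun h => rightReg_ind H h A
  have hlc := slice_isLocallyConstant (preim (mulMap H) A)
  refine Eq.trans ?_ (integ_comp (slice (preim (mulMap H) A)) hlc (ind k H) (hlc.comp _)
    (fun n => LinearMap.applyₗ n ∘ₗ (equivHom ρ).subtype) μ)
  rw [← integ_congr hf (((rightReg_smooth k G).orbit _).comp_continuous continuous_subtype_val)]
  rfl

theorem psi_act_apply (g : G) (φ : equivHom ρ) (s : Fn k G) :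
    ((psiObj ρ).act g φ).1 s = φ.1 (rightReg k G g s) :=
  (congrArg (fun μ => actInteg (rightReg k G) (rightReg_smooth k G) LinearMap.applyₗ s μ)
    (Meas.map_dirac (equivHom ρ).subtype g φ)).trans
    (actInteg_dirac (rightReg k G) (rightReg_smooth k G) LinearMap.applyₗ s g φ.1)

/-- Data showing that the restriction of a smooth module to a compact open subgroup `H` is cofree,
that is, isomorphic to the space of locally constant functions from `H` to a vector space `E`:
the map `e` to the space of cogenerators, and the map `ι` taking an element `x` of `E` to the
morphism from `S` corresponding to the point measure at `1` with the value `x`. -/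
structure CofreeOn (ρ : Representation k G M) where
  E : Type u
  [addCommGroup : AddCommGroup E]
  [module : Module k E]
  e : M →ₗ[k] E
  ι : E →ₗ[k] equivHom ρ
  inj : ∀ m, (∀ h : H, e (ρ h m) = 0) → m = 0
  gen : ∀ x (A : Clopens H), e ((ι x).1 (ind k H A)) = (ind k H A).1 1 • x

attribute [instance] CofreeOn.addCommGroup CofreeOn.module

namespace CofreeOn

variable {H} (c : CofreeOn H ρ)

/-- The measure on `H` with values in the space of cogenerators that corresponds to a morphism
from `S`. -/
def meas : equivHom ρ →ₗ[k] Meas k H c.E where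
  toFun φ := ⟨fun A => c.e (φ.1 (ind k H A)),
    fun A B h => by simp only [ind_sup H A B h, map_add], Set.univ, isCompact_univ, fun A h => by
      simp only [ind_of_eq_empty H A (Set.disjoint_univ.1 h), map_zero]⟩
  map_add' φ ψ := Meas.ext fun A => map_add c.e _ _
  map_smul' a φ := Meas.ext fun A => map_smul c.e a _

theorem meas_apply (φ : equivHom ρ) (A : Clopens H) :
    (c.meas φ).1 A = c.e (φ.1 (ind k H A)) := rfl

section

variable [T2Space G] [LocallyCompactSpace G] [TotallyDisconnectedSpace G]

/-- Since `S` is spanned by left translates of the functions `1_K` with `K ≤ H`, it is enough to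
show `φ(1_K) = 0`. For `h` in `H`, `e(h φ(1_K)) = e(φ(1_{hK}))` is a value of the measure of `φ`,
hence zero, and `inj` applies. -/
theorem meas_injective : Function.Injective c.meas := by
  rw [← LinearMap.ker_eq_bot, Submodule.eq_bot_iff]
  intro φ hφ
  refine Subtype.ext (LinearMap.ext fun s => ?_)
  have hH : (H : Set G) ∈ nhds (1 : G) := CompactOpen.isOpen.mem_nhds H.one_mem
  obtain ⟨K, _, hK⟩ := exists_compactOpen_subset (Filter.inter_mem
    ((rightReg_smooth k G s).mem_nhds (by simp)) hH)
  have hs := mem_span_leftReg K s fun h hh => (hK hh).1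
  refine Submodule.span_induction (p := fun s _ => φ.1 s = 0) ?_ (map_zero _)
    (fun s t _ _ hs ht => by rw [map_add, hs, ht, add_zero])
    (fun a s _ hs => by rw [map_smul, hs, smul_zero]) hs
  rintro _ ⟨g, rfl⟩
  change φ.1 (leftReg k G g (ind k K ⊤)) = 0
  rw [φ.2 g, c.inj (φ.1 (ind k K ⊤)), map_zero]
  intro h
  obtain ⟨A, hA⟩ := exists_ind_eq_of_le (k := k) H (fun x hx => (hK hx).2 : K ≤ H) h
  rw [← φ.2 h, hA, ← c.meas_apply, LinearMap.mem_ker.1 hφ]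
  rfl

/-- Each `φ` is recovered from its measure: compare measures at `A`. By `gen`, the integrand at `h`
contributes its value exactly when `1` lies in `Ah⁻¹`, that is, when `h ∈ A`. -/
theorem pi_meas (φ : equivHom ρ) :
    (psiObj ρ).π (Meas.push (incl H) (Meas.map c.ι (c.meas φ))) = φ := by
  classical
  refine c.meas_injective (Meas.ext fun A => ?_)
  let C := preim (mulMap H) A
  have hlc := slice_isLocallyConstant C
  -- Integrating `F` against the truth value of `h ∈ A` returns the measure of `A`; this truth value
  -- depends on `h` only through the slice at `h`.
  let F : Prop → c.E →ₗ[k] c.E := fun p => if p then LinearMap.id else 0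
  have hmem : IsLocallyConstant fun h : H => h ∈ A := isLocallyConstant_mem A.isClopen
  have hcomp : (fun h : H => h ∈ A) = (fun B : Clopens H => (1 : H) ∈ B) ∘ slice C :=
    funext fun h => by
      change (h ∈ A) = (1 * h ∈ A)
      rw [one_mul]
  have hF : (c.meas φ).1 A = F True ((c.meas φ).1 A) := by simp only [F, if_true, LinearMap.id_apply]
  rw [meas_apply, psi_pi_ind, hF, ← integ_mem A hmem F (if_neg not_false),
    integ_congr hcomp hmem (hlc.comp _), integ_comp _ hlc]
  refine (c.e.toAddMonoidHom.map_finsum (Meas.support_finite _ _ hlc _)).trans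
    (finsum_congr fun B => ?_)
  refine (c.gen ((c.meas φ).1 (fib _ hlc B)) B).trans ?_
  by_cases hB : (1 : H) ∈ B
  · have h1 : (ind k H B).1 1 = 1 := ind_apply_of_mem H hB
    simp only [F, if_pos hB, h1, one_smul, LinearMap.id_apply]
  · have h1 : (ind k H B).1 1 = 0 := ind_apply_of_notMem H hB
    simp only [F, if_neg hB, h1, zero_smul, LinearMap.zero_apply]

end

/-- Both sides are `H`-invariant, the left one because left translations by `H` fix `1_H`, and both
have the image `e m` under `e`. -/
theorem apply_ind_top (m : M) (hm : ∀ h : H, ρ h m = m) : (c.ι (c.e m)).1 (ind k H ⊤) = m := by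
  refine sub_eq_zero.1 (c.inj _ fun h => ?_)
  have h1 : (ind k H ⊤).1 1 = 1 := ind_apply_of_mem H (h := 1) (A := ⊤) (Set.mem_univ _)
  rw [map_sub, hm, ← (c.ι (c.e m)).2, leftReg_ind, map_sub]
  have h2 : preim ⟨fun x => h⁻¹ * x, by fun_prop⟩ (⊤ : Clopens H) = ⊤ := rfl
  rw [h2, c.gen, h1, one_smul, sub_self]

end CofreeOn

end

/-- Injectivity: write the element as `1_K ⊗ φ`, so that `φ(1_K) = 0`. Since `φ = π(μ)` with `μ(A) =
ι(e(φ(1_A)))`, the element equals `1_K ⊗ μ(K)`, which is zero. Surjectivity: a vector `m` fixed by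
`K` is the value at `1_K` of the morphism `ι(e(m))`. -/
theorem isIso_counit_of_cofreeOn [T2Space G] [LocallyCompactSpace G] [TotallyDisconnectedSpace G]
    (M : SmoothMod k G) (c : ∀ (H : Subgroup G) [CompactOpen H], CofreeOn H M.obj.ρ) :
    IsIso ((phiPsiAdj k G).counit.app M) := by
  refine SmoothMod.isIso_of_bijective _ ⟨?_, fun m => ?_⟩
  · rw [← LinearMap.ker_eq_bot, Submodule.eq_bot_iff]
    intro t ht
    obtain ⟨U, hU, h⟩ := exists_eq_phiMk (psiObj M.obj.ρ) t
    obtain ⟨K, _, hK⟩ := exists_compactOpen_subset hU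
    obtain ⟨φ, rfl⟩ := h K hK
    have hφ : (φ : equivHom M.obj.ρ).1 (ind k K ⊤) = 0 :=
      (phiPsiAdj_counit_mk M _ φ).symm.trans ht
    rw [← (c K).pi_meas φ]
    refine (phiMk_ind_top_pi K _ _).trans ?_
    rw [Meas.map_apply, CofreeOn.meas_apply, hφ, map_zero, map_zero]
    exact map_zero _
  · obtain ⟨K, _, hK⟩ := exists_compactOpen_subset ((M.property m).mem_nhds (by simp))
    have hφ := (c K).apply_ind_top m fun h => hK h.2
    exact ⟨phiMk (psiObj M.obj.ρ) (ind k K ⊤) _, (phiPsiAdj_counit_mk M _ _).trans hφ⟩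

end

section

/-! ### Measures on products of compact spaces -/

section Product

variable {k : Type*} [Field k] {X Y : Type*} [TopologicalSpace X] [TopologicalSpace Y]
  [CompactSpace X] [CompactSpace Y] {V : Type*} [AddCommGroup V] [Module k V]

variable (k V) in
/-- The evaluation of measures on an open-closed set. -/
def Meas.eval (A : Clopens X) : Meas k X V →ₗ[k] V := LinearMap.proj A ∘ₗ (Meas k X V).subtype

/-- The measure on the product of two compact spaces that corresponds to a measure with values in
measures: its value on an open-closed set `C` is the integral of the values of the measures on the
slices of `C`. -/
def Meas.uncurry (κ : Meas k Y (Meas k X V)) : Meas k (X × Y) V :=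
  ⟨fun C => integ (slice C) (slice_isLocallyConstant C) (Meas.eval k V) κ, by
    refine ⟨fun C C' h => ?_, Set.univ, isCompact_univ, fun C hC => ?_⟩
    · have hf := (slice_isLocallyConstant C).prodMk (slice_isLocallyConstant C')
      have h1 := integ_comp _ hf Prod.fst (slice_isLocallyConstant C) (Meas.eval k V) κ
      have h2 := integ_comp _ hf Prod.snd (slice_isLocallyConstant C') (Meas.eval k V) κ
      have h3 := integ_comp _ hf (fun p => p.1 ⊔ p.2) (slice_isLocallyConstant (C ⊔ C'))
        (Meas.eval k V) κ
      refine h3.trans (Eq.trans ?_ (congrArg₂ (· + ·) h1 h2).symm)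
      simp only [integ_apply]
      rw [← finsum_add_distrib (Meas.support_finite κ _ hf fun p => Meas.eval k V p.1)
        (Meas.support_finite κ _ hf fun p => Meas.eval k V p.2)]
      refine finsum_congr fun p => ?_
      -- Disjointness is available only for pairs that occur as slices over a common point; any
      -- other pair has an empty fibre, hence measure zero.
      by_cases hp : ∃ y, (slice C y, slice C' y) = p
      · obtain ⟨y, rfl⟩ := hp
        exact Meas.add_of_disjoint _ _ _ (Set.disjoint_left.2 fun x hx hx' =>
          Set.disjoint_left.1 h hx hx')
      · rw [Meas.empty κ _ (Set.eq_empty_of_forall_notMem fun y hy => hp ⟨y, hy⟩), map_zero,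
          map_zero, map_zero, add_zero]
    · have hC : (C : Set (X × Y)) = ∅ := Set.disjoint_univ.1 hC
      change integ _ _ _ κ = 0
      rw [integ_apply, finsum_eq_zero_of_forall_eq_zero]
      intro A
      by_cases hA : ∃ y, slice C y = A
      · obtain ⟨y, rfl⟩ := hA
        exact Meas.empty _ _ (Set.eq_empty_of_forall_notMem fun x hx =>
          Set.eq_empty_iff_forall_notMem.1 hC _ hx)
      · rw [Meas.empty κ _ (Set.eq_empty_of_forall_notMem fun y hy => hA ⟨y, hy⟩), map_zero]⟩

/-- The slice of `A × B` is `A` over points of `B` and empty elsewhere, so the integral reduces to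
`κ(B)(A)`. -/
theorem Meas.curry_uncurry (κ : Meas k Y (Meas k X V)) : Meas.curry (Meas.uncurry κ) = κ := by
  classical
  refine Meas.ext fun B => Meas.ext fun A => ?_
  have hB : IsLocallyConstant fun y : Y => y ∈ B := isLocallyConstant_mem B.isClopen
  have hs : slice (prodC A B) = (fun p : Prop => if p then A else ⊥) ∘ fun y => y ∈ B := by
    refine funext fun y => Clopens.ext (Set.ext fun x => ?_)
    by_cases hy : y ∈ B
    · simp only [Function.comp_apply, if_pos hy]
      exact ⟨fun h => h.1, fun h => ⟨h, hy⟩⟩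
    · simp only [Function.comp_apply, if_neg hy]
      exact ⟨fun h => absurd h.2 hy, fun h => absurd h (Set.notMem_empty x)⟩
  change integ (slice (prodC A B)) _ (Meas.eval k V) κ = _
  rw [integ_congr hs _ (hB.comp _), integ_comp _ hB, integ_mem B hB]
  · rw [if_pos trivial]
    rfl
  · rw [if_neg not_false]
    exact LinearMap.ext fun μ => Meas.empty μ ⊥ rfl

end Product

variable {k G : Type u} [Field k] [Group G] [TopologicalSpace G] [IsTopologicalGroup G]

/-! ### Freeness of `Hom_{k[G]}(S, M)` over a compact open subgroup -/

namespace CofreeOn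

variable {H : Subgroup G} [CompactOpen H] {M : Type u} [AddCommGroup M] [Module k M]
  {ρ : Representation k G M} (c : CofreeOn H ρ)

/-- Together with `pi_meas`, this transports the contraaction of `Ψ(M)` over `H` to that of the free
contramodule `E[[H]]`. -/
theorem meas_pi (μ : Meas k H (equivHom ρ)) :
    c.meas ((psiObj ρ).π (Meas.push (incl H) μ)) =
      Meas.push (mulMap H) (Meas.uncurry (Meas.map c.meas μ)) := by
  refine Meas.ext fun A => ?_
  rw [meas_apply, psi_pi_ind]
  exact c.e.toAddMonoidHom.map_finsum (Meas.support_finite μ _ (slice_isLocallyConstant _) _)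

theorem meas_ι (x : c.E) : c.meas (c.ι x) = Meas.dirac 1 x := by
  refine Meas.ext fun A => ?_
  rw [meas_apply, gen]
  by_cases hA : (1 : H) ∈ A
  · have h1 : (ind k H A).1 1 = 1 := ind_apply_of_mem H hA
    rw [Meas.dirac_apply_of_mem hA, h1, one_smul]
  · have h1 : (ind k H A).1 1 = 0 := ind_apply_of_notMem H hA
    rw [Meas.dirac_apply_of_notMem hA, h1, zero_smul]

/-- `Hom_{k[G]}(S, M)` is a free contramodule over `H`: the morphism extending a linear map defined
on the generators. -/
def freeLift (Q : Contramodule k H) (β : c.E →ₗ[k] Q.carrier) :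
    Contramodule.Hom ((Contramodule.res k H).obj (psiObj ρ)) Q where
  lin := Q.π ∘ₗ Meas.map β ∘ₗ c.meas
  comm μ := by
    -- Associativity in `Q` speaks of measures on `H × H`; since currying is onto for compact `H`,
    -- it also applies to a measure with values in measures.
    have h1 := Q.assoc (Meas.map β (Meas.uncurry (Meas.map c.meas μ)))
    have h2 : Meas.curry (Meas.map β (Meas.uncurry (Meas.map c.meas μ))) =
        Meas.map (Meas.map β) (Meas.curry (Meas.uncurry (Meas.map c.meas μ))) := rfl
    rw [h2, Meas.curry_uncurry] at h1
    exact (congrArg (fun ν => Q.π (Meas.map β ν)) (c.meas_pi μ)).trans h1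

theorem freeLift_ι (Q : Contramodule k H) (β : c.E →ₗ[k] Q.carrier) (x : c.E) :
    (c.freeLift Q β).lin (c.ι x) = β x := by
  change Q.π (Meas.map β (c.meas (c.ι x))) = β x
  rw [meas_ι, Meas.map_dirac, Q.unit]

variable [T2Space G] [LocallyCompactSpace G] [TotallyDisconnectedSpace G]

/-- Every `φ` is the contraaction of a measure with values in the generators `ι x`, by `pi_meas`. -/
theorem free_ext {Q : Contramodule k H}
    {f f' : Contramodule.Hom ((Contramodule.res k H).obj (psiObj ρ)) Q}
    (h : ∀ x, f.lin (c.ι x) = f'.lin (c.ι x)) : f = f' := by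
  have key : ∀ (f : Contramodule.Hom ((Contramodule.res k H).obj (psiObj ρ)) Q) (φ : equivHom ρ),
      f.lin φ = Q.π (Meas.map (f.lin ∘ₗ c.ι) (c.meas φ)) := fun f φ =>
    (congrArg f.lin (c.pi_meas φ)).symm.trans (f.comm (Meas.map c.ι (c.meas φ)))
  refine Contramodule.Hom.ext (LinearMap.ext fun φ => ?_)
  rw [key f φ, key f' φ]
  exact congrArg Q.π (Meas.ext fun A => h _)

include c in
-- A linear section of the epimorphism lifts the images of the generators, and freeness extends the
-- lift.
theorem projective_res : Projective ((Contramodule.res k H).obj (psiObj ρ)) where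
  factors {Y X} f p _ := by
    obtain ⟨σ, hσ⟩ := (Contramodule.Hom.lin p).exists_rightInverse_of_surjective
      (LinearMap.range_eq_top.2 (Contramodule.surjective_of_epi p))
    refine ⟨c.freeLift Y (σ ∘ₗ Contramodule.Hom.lin f ∘ₗ c.ι), c.free_ext fun x => ?_⟩
    refine (congrArg (Contramodule.Hom.lin p) (c.freeLift_ι _ _ x)).trans ?_
    exact LinearMap.congr_fun hσ _

end CofreeOn

end

section

variable {k G : Type u} [Field k] [Group G] [TopologicalSpace G] [IsTopologicalGroup G]

/-! ### Cofreeness of `S ⊗ V` over a compact open subgroup -/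

section

variable (H : Subgroup G) [CompactOpen H]

/-- The values of a compactly supported function at the inverses of the chosen representatives
of the left cosets. -/
def cosetValues : Fn k G →ₗ[k] (G ⧸ H →₀ k) where
  toFun f := Finsupp.ofSupportFinite (fun q => f.1 q.out⁻¹) <| by
    refine (image_finite _ (leftCoset_isLocallyConstant H) _ f.2.2.inv).subset fun q hq => ?_
    refine ⟨q.out, ?_, QuotientGroup.out_eq' q⟩
    exact subset_tsupport f.1 hq
  map_add' _ _ := Finsupp.ext fun _ => rfl
  map_smul' _ _ := Finsupp.ext fun _ => rfl

theorem exists_coset_inv (x : G) : ∃ (q : G ⧸ H) (h : H), q.out * h = x := by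
  obtain ⟨h, hh⟩ := QuotientGroup.mk_out_eq_mul H x
  exact ⟨x, h⁻¹, by rw [hh]; simp⟩

theorem ind_out_inv_mul_out (A : Clopens H) (q r : G ⧸ H) (h : q ≠ r) :
    (ind k H A).1 (q.out⁻¹ * r.out) = 0 :=
  ind_apply_of_notMem_subgroup H fun h' => h (by
    rw [← QuotientGroup.eq, QuotientGroup.out_eq', QuotientGroup.out_eq'] at h'
    exact h')

end

section Tensor

variable {V : Type u} [AddCommGroup V] [Module k V]

/-- Evaluation of the elements of `S ⊗ V` at a point. -/
def tensorEval (x : G) : Fn k G ⊗[k] V →ₗ[k] V :=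
  TensorProduct.lift (LinearMap.mk₂ k (fun f v => f.1 x • v) (fun f g v => add_smul (f.1 x) (g.1 x) v)
    (fun c f v => mul_smul c (f.1 x) v) (fun f v w => smul_add (f.1 x) v w)
    fun c f v => smul_comm (f.1 x) c v)

theorem tensorEval_tmul (x : G) (f : Fn k G) (v : V) : tensorEval x (f ⊗ₜ[k] v) = f.1 x • v := rfl

/-- Expanding along a basis of `V` turns an element of `S ⊗ V` into a family of functions, whose
values are the coordinates of the evaluations. -/
theorem tensor_eq_zero (t : Fn k G ⊗[k] V) (h : ∀ x, tensorEval x t = 0) : t = 0 := by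
  classical
  let b := Module.Basis.ofVectorSpace k V
  have key : ∀ (t : Fn k G ⊗[k] V) (x : G) i,
      (TensorProduct.equivFinsuppOfBasisRight b t i).1 x = b.repr (tensorEval x t) i := by
    intro t x i
    induction t with
    | zero => simp
    | add s t hs ht =>
      rw [map_add, map_add, map_add, Finsupp.add_apply, Finsupp.add_apply, ← hs, ← ht]
      rfl
    | tmul f v =>
      rw [TensorProduct.equivFinsuppOfBasisRight_apply_tmul_apply, tensorEval_tmul, map_smul]
      exact mul_comm _ _
  rw [← (TensorProduct.equivFinsuppOfBasisRight b).map_eq_zero_iff]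
  refine Finsupp.ext fun i => Subtype.ext (funext fun x => ?_)
  rw [key, h, map_zero]
  rfl

theorem tensorEval_tensorRep (x g : G) (t : Fn k G ⊗[k] V) :
    tensorEval x (tensorRep V g t) = tensorEval (g⁻¹ * x) t := by
  induction t with
  | zero => simp
  | add s t hs ht => rw [map_add, map_add, map_add, hs, ht]
  | tmul f v => rfl

open Classical in
/-- The values at the representatives of the cosets of the elements of `S ⊗ V`. -/
def tensorCosetValues (H : Subgroup G) [CompactOpen H] : Fn k G ⊗[k] V →ₗ[k] (G ⧸ H →₀ V) :=
  (TensorProduct.finsuppScalarLeft k V (G ⧸ H)).toLinearMap ∘ₗ (cosetValues H).rTensor V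

theorem tensorCosetValues_apply (H : Subgroup G) [CompactOpen H] (t : Fn k G ⊗[k] V) (q : G ⧸ H) :
    tensorCosetValues H t q = tensorEval q.out⁻¹ t := by
  classical
  induction t with
  | zero => simp
  | add s t hs ht => rw [map_add, map_add, Finsupp.add_apply, hs, ht]
  | tmul f v => exact TensorProduct.finsuppScalarLeft_apply_tmul_apply _ _ _

variable (k G V) in
/-- The morphisms `f ↦ f ⊗ v` from `S` to `S ⊗ V`. -/
def tensorGen : V →ₗ[k] equivHom (tensorSmooth k G V).obj.ρ where
  toFun v := ⟨(TensorProduct.mk k (Fn k G) V).flip v, fun _ _ => rfl⟩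
  map_add' v w := Subtype.ext (map_add (TensorProduct.mk k (Fn k G) V).flip v w)
  map_smul' a v := Subtype.ext (map_smul (TensorProduct.mk k (Fn k G) V).flip a v)

variable (k V) in
/-- The restriction of `S ⊗ V` to a compact open subgroup is cofree. -/
def tensorCofreeOn (H : Subgroup G) [CompactOpen H] : CofreeOn H (tensorSmooth k G V).obj.ρ where
  E := G ⧸ H →₀ V
  e := tensorCosetValues H
  ι := Finsupp.lsum k fun q =>
    (psiObj (tensorSmooth k G V).obj.ρ).act q.out ∘ₗ tensorGen k G V
  inj t ht := by
    refine tensor_eq_zero t fun x => ?_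
    -- Translation by `h` followed by evaluation at `q.out⁻¹` is evaluation at `(q.out * h)⁻¹`;
    -- every point has this form.
    obtain ⟨q, h, hx⟩ := exists_coset_inv H x⁻¹
    have h1 := (tensorCosetValues_apply H _ q).symm.trans (DFunLike.congr_fun (ht h) q)
    refine Eq.trans ?_ h1
    refine Eq.trans ?_ (tensorEval_tensorRep _ _ _).symm
    rw [← mul_inv_rev, hx, inv_inv]
  gen x A := by
    induction x using Finsupp.induction_linear with
    | zero => rw [map_zero, smul_zero]; exact map_zero _
    | add x y hx hy =>
      rw [map_add, smul_add, ← hx, ← hy]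
      exact map_add (tensorCosetValues H) _ _
    | single r v =>
      rw [Finsupp.lsum_single, LinearMap.comp_apply, psi_act_apply]
      refine Finsupp.ext fun q => ?_
      refine (tensorCosetValues_apply H _ q).trans ?_
      rw [Finsupp.smul_apply]
      -- The point `q.out⁻¹ * r.out` lies outside `H` unless `q = r`, in which case it is `1`.
      change (ind k H A).1 (q.out⁻¹ * r.out) • v = _
      by_cases hq : q = r
      · subst hq
        rw [inv_mul_cancel, Finsupp.single_eq_same]
      · rw [ind_out_inv_mul_out H A q r hq, Finsupp.single_eq_of_ne hq, zero_smul, smul_zero]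

/-- The basic generators of the restriction of `S ⊗ V` to a compact open subgroup. -/
def tensorSingle (H : Subgroup G) [CompactOpen H] (q : G ⧸ H) (v : V) :
    (tensorCofreeOn (G := G) k V H).E := Finsupp.single q v

theorem tensorCofreeOn_ι_single (H : Subgroup G) [CompactOpen H] (q : G ⧸ H) (v : V) :
    (tensorCofreeOn k V H).ι (tensorSingle H q v) =
      (psiObj (tensorSmooth k G V).obj.ρ).act q.out (tensorGen k G V v) :=
  Finsupp.lsum_single _ _ _ _

theorem tensorSingle_ext (H : Subgroup G) [CompactOpen H] {W : Type*} [AddCommGroup W] [Module k W]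
    {f f' : (tensorCofreeOn k V H).E →ₗ[k] W}
    (h : ∀ q v, f (tensorSingle H q v) = f' (tensorSingle H q v)) : f = f' := by
  let g : (G ⧸ H →₀ V) →ₗ[k] W := f
  let g' : (G ⧸ H →₀ V) →ₗ[k] W := f'
  have h' : g = g' := Finsupp.lhom_ext h
  exact h'

theorem exists_tensorSingle_lift (H : Subgroup G) [CompactOpen H] {W : Type*} [AddCommGroup W]
    [Module k W] (B : G ⧸ H → V →ₗ[k] W) :
    ∃ f : (tensorCofreeOn k V H).E →ₗ[k] W, ∀ q v, f (tensorSingle H q v) = B q v := by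
  let g : (G ⧸ H →₀ V) →ₗ[k] W := Finsupp.lsum k B
  have h : ∀ q v, g (Finsupp.single q v) = B q v := fun q v => Finsupp.lsum_single _ _ _ _
  exact ⟨g, h⟩

end Tensor

end

section

variable {k G : Type u} [Field k] [Group G] [TopologicalSpace G] [IsTopologicalGroup G]

/-! ### Decomposition of measures along cosets -/

section Restrict

variable (H : Subgroup G) [hH : CompactOpen H] {V : Type*} [AddCommGroup V] [Module k V]

/-- The restriction of a measure to a compact open subgroup. -/
def Meas.restrict (μ : Meas k G V) : Meas k H V :=
  ⟨fun A => μ.1 ⟨((↑) : H → G) '' A, CompactOpen.isClopen_image H A⟩, by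
    refine ⟨fun A B h => ?_, Set.univ, isCompact_univ, fun A hA => ?_⟩
    · refine Eq.trans (congrArg μ.1 (Clopens.ext (Set.image_union _ _ _)))
        (Meas.add_of_disjoint μ _ _ ?_)
      exact Set.disjoint_image_of_injective Subtype.val_injective h
    · refine Meas.empty μ _ (Set.image_eq_empty.2 (Set.disjoint_univ.1 hA))⟩

/-- The left multiplication by an element of the group. -/
abbrev mulLeftMap (g : G) : C(G, G) := ⟨fun x => g * x, continuous_const_mul g⟩

/-- The right multiplication by an element of the group. -/
abbrev mulRightMap (g : G) : C(G, G) := ⟨fun x => x * g, continuous_mul_const g⟩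

/-- A compact support meets only finitely many left cosets of the open subgroup `H`; each piece is
translated back to `H`. -/
theorem Meas.exists_eq_sum_cosets (μ : Meas k G V) :
    ∃ (T : Finset (G ⧸ H)) (ν : G ⧸ H → Meas k H V),
      μ = ∑ q ∈ T, Meas.push (mulLeftMap q.out) (Meas.push (incl H) (ν q)) := by
  classical
  have hlc := leftCoset_isLocallyConstant H
  obtain ⟨T, hT⟩ := Meas.exists_finset μ _ hlc
  refine ⟨T, fun q => Meas.restrict H (Meas.push (mulLeftMap q.out⁻¹) μ), Meas.ext fun U => ?_⟩
  rw [Meas.sum_fib μ _ hlc T U fun B hB => hT B fun x hx => (hB x hx).2, Submodule.coe_sum,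
    Finset.sum_apply]
  refine Finset.sum_congr rfl fun q _ => congrArg μ.1 (Clopens.ext (Set.ext fun x => ?_))
  have hq : (x : G ⧸ H) = q ↔ q.out⁻¹ * x ∈ H := by
    rw [← QuotientGroup.eq, QuotientGroup.out_eq', eq_comm]
  constructor
  · rintro ⟨hx, hx'⟩
    refine ⟨⟨_, hq.1 hx'⟩, ?_, rfl⟩
    change q.out * (q.out⁻¹ * x) ∈ U
    rwa [mul_inv_cancel_left]
  · rintro ⟨h, hh, hx⟩
    have hx : (h : G) = q.out⁻¹ * x := hx
    refine ⟨?_, hq.2 (hx ▸ h.2)⟩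
    have hh : q.out * h ∈ U := hh
    rwa [hx, mul_inv_cancel_left] at hh

end Restrict

/-! ### Contramodule morphisms tested on a subgroup and on group elements -/

namespace Contramodule

variable {P Q : Contramodule k G}

/-- Compatibility of a linear map between contramodules with the measures supported on a
subgroup. -/
def IsHomOn (H : Subgroup G) (f : P.carrier →ₗ[k] Q.carrier) : Prop :=
  ∀ μ : Meas k H P.carrier,
    f (P.π (Meas.push (incl H) μ)) = Q.π (Meas.push (incl H) (Meas.map f μ))

theorem IsHomOn.mono {H K : Subgroup G} {f : P.carrier →ₗ[k] Q.carrier} (hf : IsHomOn H f)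
    (h : K ≤ H) : IsHomOn K f := fun μ =>
  hf (Meas.push ⟨Subgroup.inclusion h, continuous_inclusion h⟩ μ)

/-- The identity `x g = g (g⁻¹ x g)` turns the action of `g` on the contraaction of a measure on `K`
into the contraaction of a measure on `H`, namely the conjugated one with values acted upon by `g`.
Acting by `g⁻¹` reverses this. -/
theorem IsHomOn.conj {H K : Subgroup G} {f : P.carrier →ₗ[k] Q.carrier} (hf : IsHomOn H f) (g : G)
    (h : ∀ x ∈ K, g⁻¹ * x * g ∈ H) : IsHomOn K (Q.act g⁻¹ ∘ₗ f ∘ₗ P.act g) := fun μ => by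
  let c : C(K, H) := ⟨fun x => ⟨g⁻¹ * x * g, h x x.2⟩, by fun_prop⟩
  have h1 : (mulRightMap g).comp (incl K) = (mulLeftMap g).comp ((incl H).comp c) := by
    ext x
    simp [c, incl, mul_assoc]
  have h2 : (mulRightMap g⁻¹).comp ((incl H).comp c) = (mulLeftMap g⁻¹).comp (incl K) := by
    ext x
    simp [c, incl, mul_assoc]
  have e1 : P.act g (P.π (Meas.push (incl K) μ)) =
      P.π (Meas.push (incl H) (Meas.map (P.act g) (Meas.push c μ))) := by
    rw [act_pi]
    refine (congrArg (fun j => P.π (Meas.push j μ)) h1).trans ?_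
    exact (P.pi_map_act g (Meas.push (incl H) (Meas.push c μ))).symm
  have e2 : Q.act g⁻¹ (Q.π (Meas.push (incl H) (Meas.map f (Meas.map (P.act g)
      (Meas.push c μ))))) =
      Q.π (Meas.push (incl K) (Meas.map (Q.act g⁻¹ ∘ₗ f ∘ₗ P.act g) μ)) := by
    rw [act_pi]
    refine (congrArg (fun j => Q.π (Meas.push j (Meas.map (f ∘ₗ P.act g) μ))) h2).trans ?_
    exact (Q.pi_map_act g⁻¹ (Meas.push (incl K) (Meas.map (f ∘ₗ P.act g) μ))).symm
  rw [← e2, ← hf, ← e1]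
  rfl

/-- A measure on `G` is a finite sum of left translates of measures on `H`, and `pi_map_act` absorbs
each translation into the action of an element on the values. -/
theorem comm_of_isHomOn (H : Subgroup G) [CompactOpen H] {f : P.carrier →ₗ[k] Q.carrier}
    (hf : IsHomOn H f) (hact : ∀ g x, f (P.act g x) = Q.act g (f x)) (μ : Meas k G P.carrier) :
    f (P.π μ) = Q.π (Meas.map f μ) := by
  obtain ⟨T, ν, hμ⟩ := Meas.exists_eq_sum_cosets H μ
  rw [hμ, map_sum, map_sum, map_sum, map_sum]
  refine Finset.sum_congr rfl fun q _ => ?_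
  have h1 := P.pi_map_act q.out (Meas.push (incl H) (ν q))
  have h2 := Q.pi_map_act q.out (Meas.push (incl H) (Meas.map f (ν q)))
  refine (congrArg f h1).symm.trans (Eq.trans ?_ h2)
  refine (hf (Meas.map (P.act q.out) (ν q))).trans (congrArg Q.π (Meas.ext fun A => ?_))
  exact hact _ _

end Contramodule

/-! ### The free contramodule `Hom_{k[G]}(S, S ⊗ V)` and its universal property -/

section Lift

variable {V : Type u} [AddCommGroup V] [Module k V] [T2Space G] [LocallyCompactSpace G]
  [TotallyDisconnectedSpace G]

variable (k G V) in
/-- The projective contramodule `Hom_{k[G]}(S, S ⊗ V)` freely generated by a vector space `V`. -/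
abbrev projObj : Contramodule k G := psiObj (tensorSmooth k G V).obj.ρ

/-- Over `H`, the translates of the copy of `V` by coset representatives are free generators. -/
theorem projObj_ext_on {Q : Contramodule k G} (H : Subgroup G) [CompactOpen H]
    {f f' : (projObj k G V).carrier →ₗ[k] Q.carrier} (hf : Contramodule.IsHomOn H f)
    (hf' : Contramodule.IsHomOn H f') (h : ∀ g v, f ((projObj k G V).act g (tensorGen k G V v)) =
      f' ((projObj k G V).act g (tensorGen k G V v))) : f = f' := by
  have h1 : f ∘ₗ (tensorCofreeOn k V H).ι = f' ∘ₗ (tensorCofreeOn k V H).ι :=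
    tensorSingle_ext H fun q v => by
      rw [LinearMap.comp_apply, LinearMap.comp_apply, tensorCofreeOn_ι_single]
      exact h _ _
  exact congrArg Contramodule.Hom.lin ((tensorCofreeOn k V H).free_ext
    (Q := (Contramodule.res k H).obj Q) (f := ⟨f, hf⟩) (f' := ⟨f', hf'⟩) (LinearMap.congr_fun h1))

/-- The map is prescribed on the translates by coset representatives; writing `g = q.out * h` and
using linearity over `H` gives its values at all translates. -/
theorem exists_projObj_lift_on (Q : Contramodule k G) (α : V →ₗ[k] Q.carrier) (H : Subgroup G)
    [CompactOpen H] : ∃ f : (projObj k G V).carrier →ₗ[k] Q.carrier, Contramodule.IsHomOn H f ∧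
      ∀ g v, f ((projObj k G V).act g (tensorGen k G V v)) = Q.act g (α v) := by
  obtain ⟨β, hβ⟩ := exists_tensorSingle_lift (k := k) (V := V) H fun q => Q.act q.out ∘ₗ α
  let Q' := (Contramodule.res k H).obj Q
  have h1 : ∀ (q : G ⧸ H) v, ((tensorCofreeOn k V H).freeLift Q' β).lin
      ((projObj k G V).act q.out (tensorGen k G V v)) = Q.act q.out (α v) := fun q v => by
    rw [← tensorCofreeOn_ι_single]
    exact ((tensorCofreeOn k V H).freeLift_ι Q' β _).trans (hβ q v)
  refine ⟨((tensorCofreeOn k V H).freeLift Q' β).lin,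
    ((tensorCofreeOn k V H).freeLift Q' β).comm, fun g v => ?_⟩
  obtain ⟨q, h, rfl⟩ := exists_coset_inv H g
  rw [← Contramodule.act_act, ← Contramodule.act_act, ← h1]
  exact Contramodule.hom_act ((tensorCofreeOn k V H).freeLift Q' β) h _

/-- Only commutation of the `H`-linear lift with the action of each `g` has to be added. The lift
and its conjugate by `g` are both linear over a small enough `K` and agree on all translates of the
generators, so they coincide. -/
theorem exists_projObj_lift (Q : Contramodule k G) (α : V →ₗ[k] Q.carrier) :
    ∃ f : projObj k G V ⟶ Q, ∀ v, Contramodule.Hom.lin f (tensorGen k G V v) = α v := by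
  obtain ⟨H, _, -⟩ := exists_compactOpen_subset (G := G) Filter.univ_mem
  obtain ⟨f, hf, hα⟩ := exists_projObj_lift_on Q α H
  have hH : (H : Set G) ∈ nhds (1 : G) := CompactOpen.isOpen.mem_nhds H.one_mem
  refine ⟨⟨f, Contramodule.comm_of_isHomOn H hf fun g x => ?_⟩, fun v => ?_⟩
  · have hU : (fun x => g⁻¹ * x * g) ⁻¹' (H : Set G) ∈ nhds (1 : G) :=
      (Continuous.continuousAt (by fun_prop)).preimage_mem_nhds (by simpa using hH)
    -- `K` lies in `H` and is conjugated into `H` by `g`, so both maps are linear over it.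
    obtain ⟨K, _, hK⟩ := exists_compactOpen_subset (Filter.inter_mem hH hU)
    have h1 := projObj_ext_on K (hf.mono fun x hx => (hK hx).1)
      (hf.conj g fun x hx => (hK hx).2) fun y v => by
        rw [LinearMap.comp_apply, LinearMap.comp_apply, Contramodule.act_act, hα, hα,
          Contramodule.act_act, mul_inv_cancel_right]
    conv_rhs => rw [h1]
    rw [LinearMap.comp_apply, LinearMap.comp_apply, Contramodule.act_act, inv_mul_cancel,
      Contramodule.act_one]
  · have h1 := hα 1 v
    rwa [Contramodule.act_one, Contramodule.act_one] at h1

theorem projObj_ext {Q : Contramodule k G} {f f' : projObj k G V ⟶ Q}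
    (h : ∀ v, Contramodule.Hom.lin f (tensorGen k G V v) =
      Contramodule.Hom.lin f' (tensorGen k G V v)) : f = f' := by
  obtain ⟨H, _, -⟩ := exists_compactOpen_subset (G := G) Filter.univ_mem
  refine Contramodule.hom_ext (projObj_ext_on H (fun μ => f.comm _) (fun μ => f'.comm _)
    fun g v => ?_)
  rw [Contramodule.hom_act, Contramodule.hom_act, h]

instance projective_projObj : Projective (projObj k G V) where
  factors {Y X} f p _ := by
    obtain ⟨σ, hσ⟩ := (Contramodule.Hom.lin p).exists_rightInverse_of_surjective
      (LinearMap.range_eq_top.2 (Contramodule.surjective_of_epi p))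
    obtain ⟨f', hf'⟩ := exists_projObj_lift Y (σ ∘ₗ Contramodule.Hom.lin f ∘ₗ tensorGen k G V)
    refine ⟨f', projObj_ext fun v => ?_⟩
    refine (congrArg (Contramodule.Hom.lin p) (hf' v)).trans ?_
    exact LinearMap.congr_fun hσ _

theorem exists_epi_projObj (P : Contramodule k G) : ∃ f : projObj k G P.carrier ⟶ P, Epi f := by
  obtain ⟨f, hf⟩ := exists_projObj_lift P LinearMap.id
  exact ⟨f, Contramodule.epi_of_surjective f fun x => ⟨_, hf x⟩⟩

theorem exists_retract_projObj (P : Contramodule k G) [Projective P] :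
    Nonempty (Retract P (projObj k G P.carrier)) := by
  obtain ⟨f, _⟩ := exists_epi_projObj P
  exact ⟨⟨Projective.factorThru (𝟙 P) f, f, Projective.factorThru_comp _ _⟩⟩

end Lift

end

section

variable {k G : Type u} [Field k] [Group G] [TopologicalSpace G] [IsTopologicalGroup G]

/-! ### Cofree smooth modules -/

section CofreeSmooth

variable {V : Type u} [AddCommGroup V] [Module k V]

variable (k G V) in
/-- The space of functions `G → V` that are invariant under the right translations by some open
subgroup. -/
def smoothFn : Submodule k (G → V) where
  carrier := {f | {h : G | ∀ g, f (g * h) = f g} ∈ nhds (1 : G)}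
  zero_mem' := by simp
  add_mem' {f f'} hf hf' := by
    filter_upwards [hf, hf'] with h h1 h2 g
    rw [Pi.add_apply, Pi.add_apply, h1, h2]
  smul_mem' c f hf := by
    filter_upwards [hf] with h h1 g
    rw [Pi.smul_apply, Pi.smul_apply, h1]

variable (k G V) in
/-- The action of `G` on the space of uniformly locally constant functions by right translations. -/
def smoothFnRep : Representation k G (smoothFn k G V) where
  toFun x :=
    { toFun := fun f => ⟨fun g => f.1 (g * x), by
        have hc : (fun h => x⁻¹ * h * x) ⁻¹' {h : G | ∀ g, f.1 (g * h) = f.1 g} ∈ nhds (1 : G) :=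
          (Continuous.continuousAt (by fun_prop)).preimage_mem_nhds (by
            rw [mul_one, inv_mul_cancel]
            exact f.2)
        filter_upwards [hc] with h hh g
        rw [← hh (g * x)]
        exact congrArg f.1 (by group)⟩
      map_add' := fun _ _ => rfl
      map_smul' := fun _ _ => rfl }
  map_one' := by ext f x; simp
  map_mul' g h := by ext f x; simp [mul_assoc]

variable (k G V) in
/-- The cofree smooth `G`-module cogenerated by a vector space `V`. -/
def cofreeSmooth : SmoothMod k G :=
  ⟨Rep.of (smoothFnRep k G V), isSmooth_of_mem_nhds fun f => by
    filter_upwards [f.2] with h hh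
    exact Subtype.ext (funext hh)⟩

/-- An equivariant map to the cofree module extends along a monomorphism of smooth modules over a
group `H` mapping to `G` in such a way that `G` is the product of a set of representatives
and `H`. -/
theorem exists_smoothFn_extension {H : Type u} [Group H] [TopologicalSpace H] [IsTopologicalGroup H]
    (j : H →* G) (hj : ∀ U ∈ nhds (1 : H), j '' U ∈ nhds (1 : G)) (r : G → G) (t : G → H)
    (hrt : ∀ g, r g * j (t g) = g) (hr : ∀ g h, r (g * j h) = r g)
    (ht : ∀ g h, t (g * j h) = t g * h) {X Y : SmoothMod k H} (f : X ⟶ Y) [Mono f]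
    (φ : X.obj.V →ₗ[k] smoothFn k G V)
    (hφ : ∀ h x, φ (X.obj.ρ h x) = smoothFnRep k G V (j h) (φ x)) :
    ∃ ψ : Y.obj.V →ₗ[k] smoothFn k G V,
      (∀ h y, ψ (Y.obj.ρ h y) = smoothFnRep k G V (j h) (ψ y)) ∧
      ∀ x, ψ (SmoothMod.lin f x) = φ x := by
  obtain ⟨p, hp⟩ := (SmoothMod.lin f).exists_leftInverse_of_injective
    (LinearMap.ker_eq_bot.2 (SmoothMod.injective_of_mono f))
  -- Equivariance forces `ψ(y)(g) = ψ(t(g) y)(r(g))`. The formula makes a free choice at the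
  -- representatives: there `ψ` is `φ` composed with a merely linear left inverse `p` of `f`.
  refine ⟨{ toFun := fun y => ⟨fun g => (φ (p (Y.obj.ρ (t g) y))).1 (r g), ?_⟩
            map_add' := fun y z => ?_
            map_smul' := fun c y => ?_ }, fun h y => ?_, fun x => ?_⟩
  · filter_upwards [hj _ ((Y.property y).mem_nhds (by simp))]
    rintro _ ⟨h, hh, rfl⟩ g
    have hh : Y.obj.ρ h y = y := hh
    rw [hr, ht, map_mul, Module.End.mul_apply, hh]
  · refine Subtype.ext (funext fun g => ?_)
    simp only [map_add]
    rfl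
  · refine Subtype.ext (funext fun g => ?_)
    simp only [map_smul]
    rfl
  · refine Subtype.ext (funext fun g => ?_)
    change (φ (p (Y.obj.ρ (t g) (Y.obj.ρ h y)))).1 (r g) =
      (φ (p (Y.obj.ρ (t (g * j h)) y))).1 (r (g * j h))
    rw [hr, ht, map_mul, Module.End.mul_apply]
  · refine Subtype.ext (funext fun g => ?_)
    change (φ (p (Y.obj.ρ (t g) (SmoothMod.lin f x)))).1 (r g) = (φ x).1 g
    have h1 : p (SmoothMod.lin f (X.obj.ρ (t g) x)) = X.obj.ρ (t g) x := LinearMap.congr_fun hp _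
    rw [← SmoothMod.lin_comm, h1, hφ]
    exact congrArg (φ x).1 (hrt g)

instance injective_cofreeSmooth : Injective (cofreeSmooth k G V) where
  factors {X Y} φ f _ := by
    obtain ⟨ψ, h1, h2⟩ := exists_smoothFn_extension (V := V) (MonoidHom.id G)
      (fun U hU => by simpa using hU) (fun _ => 1) id (fun g => one_mul g) (fun _ _ => rfl)
      (fun _ _ => rfl) f (SmoothMod.lin φ) (SmoothMod.lin_comm φ)
    exact ⟨SmoothMod.ofLin (N := cofreeSmooth k G V) ψ h1, SmoothMod.hom_ext (LinearMap.ext h2)⟩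

theorem injective_res_cofreeSmooth (H : Subgroup G) (hH : IsOpen (H : Set G)) :
    Injective ((SmoothMod.res k H).obj (cofreeSmooth k G V)) where
  factors {X Y} φ f _ := by
    have hout : ∀ (g : G) (h : H), ((g * h : G) : G ⧸ H) = (g : G ⧸ H) := fun g h =>
      QuotientGroup.mk_mul_of_mem g h.2
    have hmem : ∀ g : G, (g : G ⧸ H).out⁻¹ * g ∈ H := fun g => by
      rw [← QuotientGroup.eq, QuotientGroup.out_eq']
    obtain ⟨ψ, h1, h2⟩ := exists_smoothFn_extension (V := V) H.subtype
      (fun U hU => hH.isOpenMap_subtype_val.image_mem_nhds hU) (fun g => (g : G ⧸ H).out)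
      (fun g => ⟨_, hmem g⟩) (fun g => mul_inv_cancel_left _ g)
      (fun g h => congrArg Quotient.out (hout g h))
      (fun g h => Subtype.ext ((congrArg (fun q : G ⧸ H => q.out⁻¹ * (g * h)) (hout g h)).trans
        (mul_assoc _ _ _).symm)) f (SmoothMod.lin φ) (SmoothMod.lin_comm φ)
    exact ⟨SmoothMod.ofLin (N := (SmoothMod.res k H).obj (cofreeSmooth k G V)) ψ h1,
      SmoothMod.hom_ext (LinearMap.ext h2)⟩

/-- The orbit map `m ↦ (g ↦ g m)` is an embedding, since the value at `1` recovers `m`. -/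
theorem exists_mono_cofreeSmooth (M : SmoothMod k G) :
    ∃ f : M ⟶ cofreeSmooth k G M.obj.V, Mono f := by
  let F : M.obj.V →ₗ[k] smoothFn k G M.obj.V :=
    { toFun := fun m => ⟨fun g => M.obj.ρ g m, by
        filter_upwards [(M.property m).mem_nhds (by simp)] with h hh g
        have hh : M.obj.ρ h m = m := hh
        rw [map_mul, Module.End.mul_apply, hh]⟩
      map_add' := fun m n => Subtype.ext (funext fun g => map_add (M.obj.ρ g) m n)
      map_smul' := fun c m => Subtype.ext (funext fun g => map_smul (M.obj.ρ g) c m) }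
  have hF : ∀ g m, F (M.obj.ρ g m) = smoothFnRep k G M.obj.V g (F m) := fun g m =>
    Subtype.ext (funext fun x => by
      change M.obj.ρ x (M.obj.ρ g m) = M.obj.ρ (x * g) m
      rw [map_mul, Module.End.mul_apply])
  refine ⟨SmoothMod.ofLin (N := cofreeSmooth k G M.obj.V) F hF, ⟨fun {X} a b h => ?_⟩⟩
  refine SmoothMod.hom_ext (LinearMap.ext fun x => ?_)
  have h1 : F (SmoothMod.lin a x) = F (SmoothMod.lin b x) :=
    LinearMap.congr_fun (congrArg SmoothMod.lin h) x
  have h2 : M.obj.ρ 1 (SmoothMod.lin a x) = M.obj.ρ 1 (SmoothMod.lin b x) :=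
    congrFun (congrArg Subtype.val h1) 1
  simpa using h2

theorem exists_retract_cofreeSmooth (M : SmoothMod k G) [Injective M] :
    Nonempty (Retract M (cofreeSmooth k G M.obj.V)) := by
  obtain ⟨f, _⟩ := exists_mono_cofreeSmooth M
  exact ⟨⟨f, Injective.factorThru (𝟙 M) f, Injective.comp_factorThru _ _⟩⟩

/-- The morphism from `S` to the cofree module determined by a linear map. -/
def toCofree : (Fn k G →ₗ[k] V) →ₗ[k] equivHom (cofreeSmooth k G V).obj.ρ where
  toFun ψ :=
    ⟨{ toFun := fun s => ⟨fun g => ψ (leftReg k G g s), by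
          filter_upwards [(leftReg_smooth k G s).mem_nhds (by simp)] with h hh g
          have hh : leftReg k G h s = s := hh
          rw [map_mul, Module.End.mul_apply, hh]⟩
       map_add' := fun s s' => Subtype.ext (funext fun g => by
          change ψ (leftReg k G g (s + s')) = ψ (leftReg k G g s) + ψ (leftReg k G g s')
          rw [map_add, map_add])
       map_smul' := fun c s => Subtype.ext (funext fun g => by
          change ψ (leftReg k G g (c • s)) = c • ψ (leftReg k G g s)
          rw [map_smul, map_smul]) }, fun g s => Subtype.ext (funext fun x => by
        change ψ (leftReg k G x (leftReg k G g s)) = ψ (leftReg k G (x * g) s)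
        rw [map_mul, Module.End.mul_apply])⟩
  map_add' _ _ := rfl
  map_smul' _ _ := rfl

variable (k V) in
/-- The evaluation of smooth functions at an element of the group. -/
def cofreeEval (g : G) : (cofreeSmooth k G V).obj.V →ₗ[k] V :=
  LinearMap.proj g ∘ₗ (smoothFn k G V).subtype

theorem cofreeEval_ρ (g h : G) (f : (cofreeSmooth k G V).obj.V) :
    cofreeEval k V g ((cofreeSmooth k G V).obj.ρ h f) = cofreeEval k V (g * h) f := rfl

theorem cofree_ext {f f' : (cofreeSmooth k G V).obj.V}
    (h : ∀ g, cofreeEval k V g f = cofreeEval k V g f') : f = f' := Subtype.ext (funext h)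

variable (k V) in
/-- The restriction of a cofree module to a compact open subgroup is cofree. -/
def cofreeCofreeOn (H : Subgroup G) [CompactOpen H] : CofreeOn H (cofreeSmooth k G V).obj.ρ where
  E := G ⧸ H → V
  e := LinearMap.pi fun q => cofreeEval k V q.out
  ι := toCofree ∘ₗ
    -- `cosetValues` samples at inverses of representatives, so after inversion this is the
    -- functional `s ↦ ∑ s(q.out) x(q)`.
    { toFun := fun x => Finsupp.linearCombination k x ∘ₗ cosetValues H ∘ₗ invFn
      map_add' := fun x y => LinearMap.ext fun s => by
        simp [Finsupp.linearCombination_apply, Finsupp.sum, Finset.sum_add_distrib]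
      map_smul' := fun c x => LinearMap.ext fun s => by
        simp [Finsupp.linearCombination_apply, Finsupp.sum, Finset.smul_sum, smul_comm c] }
  inj f hf := cofree_ext fun g => by
    obtain ⟨q, h, rfl⟩ := exists_coset_inv H g
    exact congrFun (hf h) q
  gen x A := funext fun q => by
    change Finsupp.linearCombination k x (cosetValues H (invFn (leftReg k G q.out (ind k H A)))) = _
    have h : cosetValues H (invFn (leftReg k G q.out (ind k H A))) =
        Finsupp.single q ((ind k H A).1 1) := Finsupp.ext fun r => by
      change (ind k H A).1 (q.out⁻¹ * (r.out⁻¹)⁻¹) = _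
      rw [inv_inv]
      by_cases hr : q = r
      · subst hr
        rw [inv_mul_cancel, Finsupp.single_eq_same]
      · rw [ind_out_inv_mul_out H A q r hr, Finsupp.single_eq_of_ne (Ne.symm hr)]
    rw [h, Finsupp.linearCombination_single, Pi.smul_apply]

variable (k G V) in
/-- The morphism from `Ψ_G` of a cofree module to the contramodule `Hom_k(S, V)`. -/
def psiCofreeHom : Contramodule.Hom (psiObj (cofreeSmooth k G V).obj.ρ)
    (homContra (leftReg k G) (leftReg_smooth k G) V) where
  lin :=
    -- The inversion is needed because the contraaction on the source comes from right translations
    -- on `S`, and on the target from left ones.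
    { toFun := fun φ => cofreeEval k V 1 ∘ₗ φ.1 ∘ₗ invFn
      map_add' := fun _ _ => rfl
      map_smul' := fun _ _ => rfl }
  comm μ := LinearMap.ext fun s => by
    have hlc := (leftReg_smooth k G).orbit s
    have hf : (fun g => rightReg k G g (invFn s)) = invFn ∘ fun g => leftReg k G g s :=
      funext fun g => (invFn_leftReg g s).symm
    refine ((cofreeEval k V 1).toAddMonoidHom.map_finsum (Meas.support_finite
      (Meas.map (equivHom (cofreeSmooth k G V).obj.ρ).subtype μ) _
      ((rightReg_smooth k G).orbit (invFn s)) fun n => LinearMap.applyₗ n)).trans ?_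
    have h1 := integ_congr (k := k) hf ((rightReg_smooth k G).orbit (invFn s)) (hlc.comp _)
      (fun n => cofreeEval k V 1 ∘ₗ LinearMap.applyₗ n ∘ₗ
        (equivHom (cofreeSmooth k G V).obj.ρ).subtype)
    exact (LinearMap.congr_fun h1 μ).trans (integ_comp _ hlc invFn (hlc.comp _) _ μ)

/-- Frobenius reciprocity: an equivariant `φ` is determined by the functional `s ↦ φ(s)(1)`, as
`φ(s)(g) = φ(g s)(1)`, and every functional arises. -/
theorem psiCofreeHom_bijective : Function.Bijective (psiCofreeHom k G V).lin := by
  constructor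
  · rw [← LinearMap.ker_eq_bot, Submodule.eq_bot_iff]
    intro φ hφ
    refine Subtype.ext (LinearMap.ext fun s => cofree_ext fun g => ?_)
    have h1 : cofreeEval k V 1 (φ.1 (invFn (invFn (leftReg k G g s)))) = 0 :=
      LinearMap.congr_fun (LinearMap.mem_ker.1 hφ) (invFn (leftReg k G g s))
    rw [invFn_invFn, φ.2 g, cofreeEval_ρ, one_mul] at h1
    exact h1
  · intro ψ
    refine ⟨toCofree (ψ ∘ₗ invFn), LinearMap.ext fun s => ?_⟩
    change ψ (invFn (leftReg k G 1 (invFn s))) = ψ s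
    rw [map_one, Module.End.one_apply, invFn_invFn]

variable (k G V) in
/-- `Ψ_G` takes a cofree module to the contramodule `Hom_k(S, V)`. -/
def psiCofreeIso : (Psi k G).obj (cofreeSmooth k G V) ≅
    homContra (leftReg k G) (leftReg_smooth k G) V :=
  Contramodule.isoOfBijective (psiCofreeHom k G V) psiCofreeHom_bijective

end CofreeSmooth

end

/-! ### The two halves of the proposition -/

section

variable {k G : Type u} [Field k] [Group G] [TopologicalSpace G] [IsTopologicalGroup G]

theorem enoughInjectives_smoothMod : EnoughInjectives (SmoothMod k G) where
  presentation M := by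
    obtain ⟨f, _⟩ := exists_mono_cofreeSmooth M
    exact ⟨{ J := cofreeSmooth k G M.obj.V, f := f }⟩

/-- An injective is a retract of a cofree module, and cofree modules stay injective on restriction.
-/
theorem injective_res (H : Subgroup G) (hH : IsOpen (H : Set G)) (M : SmoothMod k G)
    (hM : Injective M) : Injective ((SmoothMod.res k H).obj M) := by
  obtain ⟨r⟩ := exists_retract_cofreeSmooth M
  have := injective_res_cofreeSmooth (k := k) (V := M.obj.V) H hH
  exact (r.map (SmoothMod.res k H)).injective

variable [T2Space G] [LocallyCompactSpace G] [TotallyDisconnectedSpace G]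

theorem enoughProjectives_contramodule : EnoughProjectives (Contramodule k G) where
  presentation P := by
    obtain ⟨f, _⟩ := exists_epi_projObj P
    exact ⟨{ p := projObj k G P.carrier, f := f }⟩

/-- A projective is a retract of a free contramodule on a vector space, and that is free over `H` as
well. -/
theorem projective_res (H : Subgroup G) (hH : IsOpen (H : Set G)) (hc : IsCompact (H : Set G))
    (P : Contramodule k G) (hP : Projective P) : Projective ((Contramodule.res k H).obj P) := by
  have : CompactOpen H := ⟨hH, hc⟩
  obtain ⟨r⟩ := exists_retract_projObj P
  have := (tensorCofreeOn k P.carrier H).projective_res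
  exact (r.map (Contramodule.res k H)).projective

variable (k G) in
theorem isIso_counit_cofreeSmooth (V : Type u) [AddCommGroup V] [Module k V] :
    IsIso ((phiPsiAdj k G).counit.app (cofreeSmooth k G V)) :=
  isIso_counit_of_cofreeOn _ fun H _ => cofreeCofreeOn k V H

variable (k G) in
theorem isIso_counit_tensorSmooth (V : Type u) [AddCommGroup V] [Module k V] :
    IsIso ((phiPsiAdj k G).counit.app (tensorSmooth k G V)) :=
  isIso_counit_of_cofreeOn _ fun H _ => tensorCofreeOn k V H

variable (k G) in
theorem restrictToEquivalence_injective : RestrictToEquivalence (Psi k G) (Phi k G)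
    (fun M => Injective M) (fun P => IsSemiinjective P) := by
  -- Semiinjectives are thus the retracts of images under `Ψ` of cofree modules, which puts them
  -- within reach of the counit at cofree modules.
  have hret : ∀ P : Contramodule k G, IsSemiinjective P →
      ∃ V : ModuleCat.{u} k, Nonempty (Retract P ((Psi k G).obj (cofreeSmooth k G V))) := by
    rintro P ⟨V, ⟨r⟩⟩
    exact ⟨V, ⟨r.trans (Retract.ofIso (psiCofreeIso k G V).symm)⟩⟩
  refine restrictToEquivalence_right (phiPsiAdj k G) _ _ (fun P hP => ?_) (fun M hM => ?_)
    (fun P hP => ?_) (fun M hM => ?_)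
  · obtain ⟨V, ⟨r⟩⟩ := hret P hP
    have := isIso_counit_cofreeSmooth k G V
    exact ((r.map (Phi k G)).trans
      (Retract.ofIso (asIso ((phiPsiAdj k G).counit.app (cofreeSmooth k G V))))).injective
  · have : Injective M := hM
    obtain ⟨r⟩ := exists_retract_cofreeSmooth M
    exact ⟨ModuleCat.of k M.obj.V,
      ⟨(r.map (Psi k G)).trans (Retract.ofIso (psiCofreeIso k G M.obj.V))⟩⟩
  · obtain ⟨V, ⟨r⟩⟩ := hret P hP
    have := isIso_counit_cofreeSmooth k G V
    have := isIso_unit_of_isIso_counit (phiPsiAdj k G) (cofreeSmooth k G V)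
    exact isIso_app_of_retract (phiPsiAdj k G).unit r
  · have : Injective M := hM
    obtain ⟨r⟩ := exists_retract_cofreeSmooth M
    have := isIso_counit_cofreeSmooth k G M.obj.V
    exact isIso_app_of_retract (phiPsiAdj k G).counit r

variable (k G) in
theorem restrictToEquivalence_projective : RestrictToEquivalence (Phi k G) (Psi k G)
    (fun P => Projective P) (fun M => IsSemiprojective M) := by
  refine restrictToEquivalence_left (phiPsiAdj k G) _ _ (fun P hP => ?_) (fun M hM => ?_)
    (fun P hP => ?_) (fun M hM => ?_)
  · have : Projective P := hP
    obtain ⟨r⟩ := exists_retract_projObj P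
    have := isIso_counit_tensorSmooth k G P.carrier
    -- The counit at `S ⊗ V` identifies `Φ` of the free contramodule on `V` with `S ⊗ V`.
    let e : (Phi k G).obj (projObj k G P.carrier) ≅ tensorSmooth k G P.carrier :=
      @asIso _ _ _ _ _ this
    exact ⟨ModuleCat.of k P.carrier, ⟨(r.map (Phi k G)).trans (Retract.ofIso e)⟩⟩
  · obtain ⟨V, ⟨r⟩⟩ := hM
    have : Projective ((Psi k G).obj (tensorSmooth k G V)) := projective_projObj
    exact (r.map (Psi k G)).projective
  · have : Projective P := hP
    obtain ⟨r⟩ := exists_retract_projObj P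
    have := isIso_counit_tensorSmooth k G P.carrier
    have : IsIso ((phiPsiAdj k G).unit.app (projObj k G P.carrier)) :=
      isIso_unit_of_isIso_counit (phiPsiAdj k G) (tensorSmooth k G P.carrier)
    exact isIso_app_of_retract (phiPsiAdj k G).unit r
  · obtain ⟨V, ⟨r⟩⟩ := hM
    have := isIso_counit_tensorSmooth k G V
    exact isIso_app_of_retract (phiPsiAdj k G).counit r

end

end

end LocProf

theorem mainTheorem9 (k G : Type u) [Field k] [Group G] [TopologicalSpace G]
    [IsTopologicalGroup G] [T2Space G] [LocallyCompactSpace G] [TotallyDisconnectedSpace G] :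
    (EnoughInjectives (SmoothMod k G) ∧
      (∀ H : Subgroup G, IsOpen (H : Set G) → IsCompact (H : Set G) →
        ∀ M : SmoothMod k G, Injective M → Injective ((SmoothMod.res k H).obj M)) ∧
      (∀ M : SmoothMod k G, Injective M → IsWeaklyCompactlyInjective M) ∧
      RestrictToEquivalence (Psi k G) (Phi k G)
        (fun M => Injective M) (fun P => IsSemiinjective P)) ∧
    (EnoughProjectives (Contramodule k G) ∧
      (∀ H : Subgroup G, IsOpen (H : Set G) → IsCompact (H : Set G) →
        ∀ P : Contramodule k G, Projective P → Projective ((Contramodule.res k H).obj P)) ∧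
      (∀ P : Contramodule k G, Projective P → IsWeaklyCompactlyProjective P) ∧
      RestrictToEquivalence (Phi k G) (Psi k G)
        (fun P => Projective P) (fun M => IsSemiprojective M)) := by
  obtain ⟨H, hH, -⟩ := exists_compactOpen_subset (G := G) Filter.univ_mem
  exact ⟨⟨enoughInjectives_smoothMod, fun H hH _ => injective_res H hH,
    fun M hM => ⟨H, hH.isOpen, hH.isCompact, injective_res H hH.isOpen M hM⟩,
    restrictToEquivalence_injective k G⟩,
    ⟨enoughProjectives_contramodule, projective_res,
    fun P hP => ⟨H, hH.isOpen, hH.isCompact, projective_res H hH.isOpen hH.isCompact P hP⟩,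
    restrictToEquivalence_projective k G⟩⟩
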